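/- Let $\Bbbk$ be a perfect field, $A$ a finite-dimensional $\Bbbk$-algebra, $\mathrm{mod}\,A$ the category of finitely generated $A$-modules, $\mathrm{rad}^m$ the powers of its radical ($\mathrm{rad}^0=\mathrm{Hom}_A$) and $\mathrm{rad}^\infty=\bigcap_m\mathrm{rad}^m$. Morphisms are composed from left to right: $gf$ means first $g$, then $f$. *Categories with length.* Let $\mathcal C$ be a $\Bbbk$-linear category with finite-dimensional morphism spaces, in which distinct objects are not isomorphic and the non-invertible morphisms form an ideal $\mathcal R$. A morphism is irreducible if it lies in $\mathcal R\setminus\mathcal R^2$. $\mathcal C$ is a category *with length* if, for all objects $x,y$, all paths of irreducible morphisms from $x$ to $y$ have the same length, and $\bigcap_n\mathcal R^n=0$. *Covering property.* Let $\mathrm{ind}\,A$ be a full subcategory of $\mathrm{mod}\,A$ containing exactly one module of each isomorphism class of indecomposable modules, and let $\Gamma$ be a connected component of the Auslander–Reiten quiver (vertices: the modules in $\mathrm{ind}\,A$; an arrow $X\to Y$ if $\mathrm{rad}(X,Y)\neq\mathrm{rad}^2(X,Y)$). A $\Bbbk$-linear functor $F\colon\mathcal C\to\mathrm{ind}\,\Gamma$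 (the full subcategory on the vertices of $\Gamma$) has the *covering property* if: (a) every $X\in\Gamma$ is $Fx$ for some $x$; (b) $F(\mathcal R)\subseteq\mathrm{rad}$; (c) for all $x,y\in\mathcal C$ and $n\ge 0$ the maps induced by $F$, $\bigoplus_{Fz=Fy}\mathcal R^n(x,z)/\mathcal R^{n+1}(x,z)\to\mathrm{rad}^n(Fx,Fy)/\mathrm{rad}^{n+1}(Fx,Fy)$ and $\bigoplus_{Fz=Fy}\mathcal R^n(z,x)/\mathcal R^{n+1}(z,x)\to\mathrm{rad}^n(Fy,Fx)/\mathrm{rad}^{n+1}(Fy,Fx)$, are bijective; (d) for all $x,y$ the maps $\bigoplus_{Fz=Fy}\mathcal C(x,z)\to\mathrm{Hom}_A(Fx,Fy)$ and $\bigoplus_{Fz=Fy}\mathcal C(z,x)\to\mathrm{Hom}_A(Fy,Fx)$ are injective; (e) for $x\in\mathcal C$ and $Y\in\Gamma$ there is at most one $y$ with $Fy=Y$ and an irreducible morphism $x\to y$; (f) dually, for $X\in\Gamma$ and $y\in\mathcal C$ there is at most one $x$ with $Fx=X$ and an irreducible morphism $x\to y$. *Homogeneous morphisms.* Fix such an $F$,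 with $\mathcal C$ a category with length. A morphism $X\to Y$ in $\mathrm{mod}\,A$ is *homogeneous* with respect to direct sum decompositions $X=\bigoplus_sFx_s$, $Y=\bigoplus_tFy_t$ (finite sums) if each component $Fx_s\to Fy_t$ is $F(\varphi_{s,t})$ for some $\varphi_{s,t}\in\mathcal C(x_s,y_t)$; it is *strictly homogeneous of degree $m$* if moreover one can take $\varphi_{s,t}\in\mathcal R^m$, and $\varphi_{s,t}=0$ whenever $\varphi_{s,t}\in\mathcal R^{m+1}$. A morphism $f$ is *homogeneous up to* $\mathrm{rad}^{d+1}$ if it is the sum of a morphism that is homogeneous with respect to some decompositions of $X$ and $Y$ and of a morphism in $\mathrm{rad}^{d+1}$. For $f\in\mathrm{rad}^d$, a *homogeneous part* of $f$, with respect to given decompositions, is a morphism $f'\colon X\to Y$ that is strictly homogeneous of degree $d$ and satisfies $f-f'\in\mathrm{rad}^{d+1}$. *Left degree.* For $f\in\mathrm{rad}^d(X,Y)\setminus\mathrm{rad}^{d+1}(X,Y)$ the *left degree* of $f$ is the least $m\ge 0$ for which there are an indecomposable $Z$ and $g\in\mathrm{rad}^m(Z,X)\setminus\mathrm{rad}^{m+1}(Z,X)$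 with $gf\in\mathrm{rad}^{m+d+1}$ (and $\infty$ if there is none). **Theorem.** Let $d\ge0$ and let $f\in\mathrm{rad}^d(X,Y)\setminus\mathrm{rad}^{d+1}(X,Y)$ be homogeneous up to $\mathrm{rad}^{d+1}$ and have finite left degree $n$. Then $f$ has a homogeneous part with respect to suitable decompositions of $X$ and $Y$. Moreover, for all decompositions $X=\bigoplus_sFx_s$, $Y=\bigoplus_tFy_t$ and every homogeneous part $f'$ of $f$ with respect to them: 1. The inclusion $i\colon\mathrm{Ker}(f')\to X$ lies in $\mathrm{rad}^n\setminus\mathrm{rad}^{n+1}$. 2. There are direct sum decompositions $\mathrm{Ker}(f')=\bigl(\bigoplus_{m\ge n}K^{(m)}\bigr)\oplus K^{(\infty)}$ and $K^{(m)}=\bigoplus_rK^{(m)}_r$ (finite sums) with each $K^{(m)}_r$ indecomposable, such that the restriction of $i$ to $K^{(\infty)}$ lies in $\mathrm{rad}^\infty$, and the restriction of $i$ to each $K^{(m)}_r$ lies in $\mathrm{rad}^m\setminus\mathrm{rad}^{m+1}$ and is strictly homogeneous of degree $m$ with respect to $X=\bigoplus_sFx_s$ and some decomposition of $K^{(m)}_r$.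 3. For any decompositions as in 2, the restriction of $i$ to every indecomposable direct summand of $K^{(m)}$ lies in $\mathrm{rad}^m\setminus\mathrm{rad}^{m+1}$, and for every $\ell\ge n$ and every indecomposable $Z$ in $\mathrm{mod}\,A$ the following sequence, with maps induced by the restrictions $K^{(m)}\to X$ of $i$ and by $f$, is exact: $$0\to\bigoplus_{n\le m\le\ell}\frac{\mathrm{rad}^{\ell-m}}{\mathrm{rad}^{\ell-m+1}}(Z,K^{(m)})\to\frac{\mathrm{rad}^{\ell}}{\mathrm{rad}^{\ell+1}}(Z,X)\to\frac{\mathrm{rad}^{\ell+d}}{\mathrm{rad}^{\ell+d+1}}(Z,Y).$$ -/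

import Mathlib

open CategoryTheory DirectSum

universe w u u' v'

noncomputable section

namespace RadDegree

/-! ### Ideals of a linear category and their powers -/

section Ideals

variable (k : Type w) [Field k] {D : Type u'} [Category.{v'} D] [Preadditive D] [Linear k D]

theorem isIso_one_sub_swap {X Y : D} (f : X ⟶ Y) (g : Y ⟶ X) (h : IsIso (𝟙 X - f ≫ g)) :
    IsIso (𝟙 Y - g ≫ f) := by
  obtain ⟨u, hu1, hu2⟩ := h.out
  have e1 : f ≫ g ≫ u = u - 𝟙 X := by
    rw [Preadditive.sub_comp, Category.id_comp, Category.assoc] at hu1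
    rw [← hu1]; abel
  have e2 : u ≫ f ≫ g = u - 𝟙 X := by
    rw [Preadditive.comp_sub, Category.comp_id] at hu2
    rw [← hu2]; abel
  have e1' : f ≫ g ≫ u ≫ f = u ≫ f - f := by
    have := congrArg (fun t => t ≫ f) e1
    simpa [Preadditive.sub_comp] using this
  have e2' : u ≫ f ≫ g ≫ f = u ≫ f - f := by
    have := congrArg (fun t => t ≫ f) e2
    simpa [Preadditive.sub_comp] using this
  refine ⟨𝟙 Y + g ≫ u ≫ f, ?_, ?_⟩
  · simp only [Preadditive.sub_comp, Preadditive.comp_add, Category.id_comp, Category.comp_id,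
      Category.assoc, e1', Preadditive.comp_sub]
    abel
  · simp only [Preadditive.comp_sub, Preadditive.add_comp, Category.id_comp, Category.comp_id,
      Category.assoc, e2']
    abel

/-- The (Jacobson) radical of a linear category: `f : X ⟶ Y` is radical if `𝟙 - f ≫ g` is
invertible for every `g : Y ⟶ X`. -/
def catRad (X Y : D) : Submodule k (X ⟶ Y) where
  carrier := {f | ∀ g : Y ⟶ X, IsIso (𝟙 X - f ≫ g)}
  zero_mem' := by
    intro g
    simpa using (inferInstance : IsIso (𝟙 X))
  add_mem' := by
    intro a b ha hb g
    haveI := ha g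
    have h1 := hb (g ≫ inv (𝟙 X - a ≫ g))
    rw [← Category.assoc] at h1
    haveI := isIso_one_sub_swap (b ≫ g) (inv (𝟙 X - a ≫ g)) h1
    have : 𝟙 X - (a + b) ≫ g =
        (𝟙 X - a ≫ g) ≫ (𝟙 X - inv (𝟙 X - a ≫ g) ≫ b ≫ g) := by
      rw [Preadditive.comp_sub, IsIso.hom_inv_id_assoc, Preadditive.add_comp, Category.comp_id]
      abel
    rw [this]
    infer_instance
  smul_mem' := by
    intro c a ha g
    have := ha (c • g)
    simpa using this

theorem catRad_comp {X Y Z : D} {f : X ⟶ Y} (hf : f ∈ catRad k X Y) (g : Y ⟶ Z) :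
    f ≫ g ∈ catRad k X Z := by
  intro h
  simpa using hf (g ≫ h)

/-- The powers of an ideal `I` of a linear category: `I⁰` consists of all morphisms and
`Iⁿ⁺¹ = Iⁿ · I` (finite sums of composites). -/
def idealPow (I : ∀ X Y : D, Submodule k (X ⟶ Y)) : ℕ → ∀ X Y : D, Submodule k (X ⟶ Y)
  | 0, _, _ => ⊤
  | n + 1, X, Z => Submodule.span k
      {h | ∃ (Y : D) (f : X ⟶ Y) (g : Y ⟶ Z), f ∈ idealPow I n X Y ∧ g ∈ I Y Z ∧ h = f ≫ g}

/-- The powers `radⁿ(X, Y)` of the radical. -/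
def radPow (n : ℕ) (X Y : D) : Submodule k (X ⟶ Y) := idealPow k (catRad k) n X Y

theorem radPow_comp {n : ℕ} {X Y Z : D} {f : X ⟶ Y} (hf : f ∈ radPow k n X Y) (g : Y ⟶ Z) :
    f ≫ g ∈ radPow k n X Z := by
  cases n with
  | zero => exact Submodule.mem_top
  | succ n =>
    refine Submodule.span_induction (p := fun f _ => f ≫ g ∈ radPow k (n + 1) X Z)
      ?_ ?_ ?_ ?_ hf
    · rintro _ ⟨W, a, b, ha, hb, rfl⟩
      exact Submodule.subset_span ⟨W, a, b ≫ g, ha, catRad_comp k hb g, by simp⟩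
    · simp
    · intro a b _ _ ha hb
      rw [Preadditive.add_comp]
      exact Submodule.add_mem _ ha hb
    · intro c a _ ha
      rw [Linear.smul_comp]
      exact Submodule.smul_mem _ c ha

theorem radPow_comp_radPow {a b : ℕ} {X Y Z : D} {f : X ⟶ Y} {g : Y ⟶ Z}
    (hf : f ∈ radPow k a X Y) (hg : g ∈ radPow k b Y Z) : f ≫ g ∈ radPow k (a + b) X Z := by
  induction b generalizing Z with
  | zero => exact radPow_comp k hf g
  | succ b ih =>
    refine Submodule.span_induction (p := fun g _ => f ≫ g ∈ radPow k (a + (b + 1)) X Z)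
      ?_ ?_ ?_ ?_ hg
    · rintro _ ⟨W, p, q, hp, hq, rfl⟩
      exact Submodule.subset_span ⟨W, f ≫ p, q, ih hp, hq, by simp⟩
    · simp
    · intro p q _ _ hp hq
      rw [Preadditive.comp_add]
      exact Submodule.add_mem _ hp hq
    · intro c p _ hp
      rw [Linear.comp_smul]
      exact Submodule.smul_mem _ c hp

/-- For subspaces `N`, `P` of `V` (in practice `P ⊆ N`), the quotient `N / P`. -/
abbrev Gr {V : Type*} [AddCommGroup V] [Module k V] (N P : Submodule k V) :=
  N ⧸ P.submoduleOf N

/-- The map `N / P → N' / P'` induced by a linear map sending `N` into `N'` and `P` into `P'`. -/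
def grMap {V W : Type*} [AddCommGroup V] [Module k V] [AddCommGroup W] [Module k W]
    (φ : V →ₗ[k] W) {N P : Submodule k V} {N' P' : Submodule k W}
    (hN : ∀ v ∈ N, φ v ∈ N') (hP : ∀ v ∈ P, φ v ∈ P') : Gr k N P →ₗ[k] Gr k N' P' :=
  Submodule.mapQ _ _ (φ.restrict hN) (fun v hv => hP v.1 hv)

/-- The quotient `radⁿ(X, Y) / radⁿ⁺¹(X, Y)`. -/
abbrev RadGr (n : ℕ) (X Y : D) := Gr k (radPow k n X Y) (radPow k (n + 1) X Y)

/-- Composition with `g ∈ radᵇ(X, Y)`, as a map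
`radᵃ/radᵃ⁺¹(Z, X) → radᶜ/radᶜ⁺¹(Z, Y)` where `c = a + b`. -/
def radGrComp (Z : D) {X Y : D} (g : X ⟶ Y) {a b c : ℕ} (hg : g ∈ radPow k b X Y)
    (h : a + b = c) : RadGr k a Z X →ₗ[k] RadGr k c Z Y :=
  grMap k (Linear.rightComp k Z g)
    (fun v hv => by
      subst h
      exact radPow_comp_radPow k hv hg)
    (fun v hv => by
      subst h
      have := radPow_comp_radPow k hv hg
      rwa [Nat.add_right_comm] at this)

end Ideals

/-! ### Categories with length -/

section Length

variable (k : Type w) [Field k] {C : Type u'} [Category.{v'} C] [Preadditive C] [Linear k C]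

/-- The span of the non-invertible morphisms. In a category with length, where the
non-invertible morphisms form an ideal, it consists of the non-invertible morphisms. -/
def nonIso (x y : C) : Submodule k (x ⟶ y) := Submodule.span k {f | ¬ IsIso f}

/-- The powers `ℛⁿ(x, y)` of the ideal of non-invertible morphisms. -/
def nonIsoPow (n : ℕ) (x y : C) : Submodule k (x ⟶ y) := idealPow k (nonIso k) n x y

/-- Irreducible morphisms: those in `ℛ` and not in `ℛ²`. -/
def IsIrred {x y : C} (f : x ⟶ y) : Prop := f ∈ nonIsoPow k 1 x y ∧ f ∉ nonIsoPow k 2 x y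

/-- `HasPath k x y n`: there is a path of `n` irreducible morphisms from `x` to `y`. -/
inductive HasPath : C → C → ℕ → Prop
  | nil (x : C) : HasPath x x 0
  | cons {x y z : C} {n : ℕ} (f : y ⟶ z) (hf : IsIrred k f) (hp : HasPath x y n) :
      HasPath x z (n + 1)

variable (C) in
/-- Linear categories with length. -/
structure IsWithLength : Prop where
  /-- the morphism spaces are finite dimensional -/
  finiteDimensional : ∀ x y : C, FiniteDimensional k (x ⟶ y)
  /-- distinct objects are not isomorphic -/
  skeletal : Skeletal C
  /-- the non-invertible morphisms form an ideal -/
  not_isIso_zero : ∀ x y : C, ¬ IsIso (0 : x ⟶ y)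
  not_isIso_add : ∀ {x y : C} (f g : x ⟶ y), ¬ IsIso f → ¬ IsIso g → ¬ IsIso (f + g)
  not_isIso_comp_right : ∀ {x y z : C} (f : x ⟶ y) (g : y ⟶ z), ¬ IsIso f → ¬ IsIso (f ≫ g)
  not_isIso_comp_left : ∀ {x y z : C} (f : x ⟶ y) (g : y ⟶ z), ¬ IsIso g → ¬ IsIso (f ≫ g)
  /-- parallel paths of irreducible morphisms have the same length -/
  length_unique : ∀ {x y : C} {m n : ℕ}, HasPath k x y m → HasPath k x y n → m = n
  /-- the intersection of the powers of `ℛ` is zero -/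
  iInf_eq_bot : ∀ x y : C, ⨅ n : ℕ, nonIsoPow k n x y = ⊥

variable {D : Type*} [Category* D] [Preadditive D] [Linear k D]

theorem map_nonIsoPow (F : C ⥤ D) [F.Additive] [F.Linear k]
    (hF : ∀ {x y : C} (f : x ⟶ y), ¬ IsIso f → F.map f ∈ catRad k (F.obj x) (F.obj y))
    (n : ℕ) {x y : C} (f : x ⟶ y) (hf : f ∈ nonIsoPow k n x y) :
    F.map f ∈ radPow k n (F.obj x) (F.obj y) := by
  have h1 : ∀ {x y : C} (f : x ⟶ y), f ∈ nonIso k x y → F.map f ∈ catRad k (F.obj x) (F.obj y) := by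
    intro x y f hf
    have : nonIso k x y ≤ (catRad k (F.obj x) (F.obj y)).comap (F.mapLinearMap k) :=
      Submodule.span_le.2 fun g hg => hF g hg
    exact this hf
  induction n generalizing y with
  | zero => exact Submodule.mem_top
  | succ n ih =>
    have : nonIsoPow k (n + 1) x y ≤
        (radPow k (n + 1) (F.obj x) (F.obj y)).comap (F.mapLinearMap k) := by
      refine Submodule.span_le.2 ?_
      rintro _ ⟨z, a, b, ha, hb, rfl⟩
      exact Submodule.subset_span
        ⟨F.obj z, F.map a, F.map b, ih a ha, h1 b hb, F.map_comp a b⟩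
    exact this hf

end Length

/-! ### Finitely generated modules over a finite-dimensional algebra -/

section Modules

theorem finite_submodule (k : Type w) [Field k] {A : Type u} [Ring A] [Algebra k A]
    [FiniteDimensional k A] (X : FGModuleCat.{u} A) (S : Submodule A X) : Module.Finite A S := by
  haveI : IsNoetherianRing A := isNoetherian_of_tower k inferInstance
  infer_instance

variable (k : Type w) [Field k] {A : Type u} [Ring A] [Algebra k A]

/-- Indecomposable modules: nonzero, and not a direct sum of two nonzero submodules. -/
def IsIndec (X : FGModuleCat.{u} A) : Prop :=
  Nontrivial X ∧ ∀ p q : Submodule A X, IsCompl p q → p = ⊥ ∨ q = ⊥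

/-- `indA` contains exactly one representative of each isomorphism class of indecomposables. -/
structure IsIndRepresentatives (indA : Set (FGModuleCat.{u} A)) : Prop where
  indec : ∀ X ∈ indA, IsIndec X
  existsUnique : ∀ X : FGModuleCat.{u} A, IsIndec X → ∃! Y, Y ∈ indA ∧ Nonempty (X ≅ Y)

/-- There is an arrow `X → Y` in the Auslander-Reiten quiver with set of vertices `indA`:
the space `rad(X, Y) / rad²(X, Y)` is nonzero. -/
def ARArrow (indA : Set (FGModuleCat.{u} A)) (X Y : FGModuleCat.{u} A) : Prop :=
  X ∈ indA ∧ Y ∈ indA ∧ Nontrivial (RadGr k 1 X Y)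

/-- `Γ` is (the set of vertices of) a connected component of the Auslander-Reiten quiver. -/
def IsARComponent (indA Γ : Set (FGModuleCat.{u} A)) : Prop :=
  ∃ X₀ ∈ indA, Γ = {Y | Y ∈ indA ∧ Relation.EqvGen (ARArrow k indA) X₀ Y}

/-- The left degree of a morphism `f ∈ radᵈ ∖ radᵈ⁺¹`: the least `m` such that some
`g : Z ⟶ X` in `radᵐ ∖ radᵐ⁺¹`, with `Z` indecomposable, satisfies `g ≫ f ∈ radᵐ⁺ᵈ⁺¹`;
it is `⊤` if there is no such `m`. -/
def leftDegree (d : ℕ) {X Y : FGModuleCat.{u} A} (f : X ⟶ Y) : ℕ∞ :=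
  ⨅ m ∈ {m : ℕ | ∃ (Z : FGModuleCat.{u} A) (g : Z ⟶ X), IsIndec Z ∧ g ∈ radPow k m Z X ∧
    g ∉ radPow k (m + 1) Z X ∧ g ≫ f ∈ radPow k (m + d + 1) Z Y}, (m : ℕ∞)

variable [FiniteDimensional k A]

/-- A submodule of `X`, as an object of the category of finitely generated modules. -/
def subObj {X : FGModuleCat.{u} A} (S : Submodule A X) : FGModuleCat.{u} A :=
  haveI := finite_submodule k X S
  FGModuleCat.of A S

/-- The inclusion morphism of a submodule. -/
def subIncl {X : FGModuleCat.{u} A} (S : Submodule A X) : subObj k S ⟶ X :=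
  haveI := finite_submodule k X S
  FGModuleCat.ofHom S.subtype

end Modules

/-! ### Functors with the covering property and homogeneous morphisms -/

section Covering

variable (k : Type w) [Field k] {A : Type u} [Ring A] [Algebra k A]
variable {C : Type u'} [Category.{v'} C] [Preadditive C] [Linear k C]
variable (F : C ⥤ FGModuleCat.{u} A) [F.Additive] [F.Linear k]

/-- The map `𝒞(x, z) → Hom(Fx, Fy)` induced by `F` when `Fz = Fy`. -/
def mapTo (x : C) {y z : C} (h : F.obj z = F.obj y) : (x ⟶ z) →ₗ[k] (F.obj x ⟶ F.obj y) :=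
  (Linear.rightComp k (F.obj x) (eqToHom h)).comp (F.mapLinearMap k)

/-- The map `𝒞(z, x) → Hom(Fy, Fx)` induced by `F` when `Fz = Fy`. -/
def mapFrom (x : C) {y z : C} (h : F.obj z = F.obj y) : (z ⟶ x) →ₗ[k] (F.obj y ⟶ F.obj x) :=
  (Linear.leftComp k (F.obj x) (eqToHom h.symm)).comp (F.mapLinearMap k)

theorem mapTo_mem
    (hF : ∀ {x y : C} (f : x ⟶ y), ¬ IsIso f → F.map f ∈ catRad k (F.obj x) (F.obj y))
    (n : ℕ) (x : C) {y z : C} (h : F.obj z = F.obj y) (f : x ⟶ z)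
    (hf : f ∈ nonIsoPow k n x z) : mapTo k F x h f ∈ radPow k n (F.obj x) (F.obj y) :=
  radPow_comp k (map_nonIsoPow k F hF n f hf) _

theorem mapFrom_mem
    (hF : ∀ {x y : C} (f : x ⟶ y), ¬ IsIso f → F.map f ∈ catRad k (F.obj x) (F.obj y))
    (n : ℕ) (x : C) {y z : C} (h : F.obj z = F.obj y) (f : z ⟶ x)
    (hf : f ∈ nonIsoPow k n z x) : mapFrom k F x h f ∈ radPow k n (F.obj y) (F.obj x) := by
  have := radPow_comp_radPow k (a := 0) (f := eqToHom h.symm) Submodule.mem_top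
    (map_nonIsoPow k F hF n f hf)
  rwa [Nat.zero_add] at this

open Classical in
/-- The `k`-linear functor `F : 𝒞 ⥤ ind Γ`, seen as a functor to finitely generated modules
with values in `Γ` on objects, has the covering property. -/
structure HasCoveringProperty (Γ : Set (FGModuleCat.{u} A)) : Prop where
  obj_mem : ∀ x : C, F.obj x ∈ Γ
  exists_obj_eq : ∀ X ∈ Γ, ∃ x : C, F.obj x = X
  map_mem_rad : ∀ {x y : C} (f : x ⟶ y), ¬ IsIso f → F.map f ∈ catRad k (F.obj x) (F.obj y)
  /-- `⨁_{Fz = Fy} ℛⁿ/ℛⁿ⁺¹(x, z) → radⁿ/radⁿ⁺¹(Fx, Fy)` is bijective -/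
  bijective_to : ∀ (x y : C) (n : ℕ), Function.Bijective
    (DirectSum.toModule k {z : C // F.obj z = F.obj y} (RadGr k n (F.obj x) (F.obj y))
      (fun z => grMap k (N := nonIsoPow k n x z.1) (P := nonIsoPow k (n + 1) x z.1)
        (mapTo k F x z.2) (mapTo_mem k F map_mem_rad n x z.2)
        (mapTo_mem k F map_mem_rad (n + 1) x z.2)))
  /-- `⨁_{Fz = Fy} ℛⁿ/ℛⁿ⁺¹(z, x) → radⁿ/radⁿ⁺¹(Fy, Fx)` is bijective -/
  bijective_from : ∀ (x y : C) (n : ℕ), Function.Bijective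
    (DirectSum.toModule k {z : C // F.obj z = F.obj y} (RadGr k n (F.obj y) (F.obj x))
      (fun z => grMap k (N := nonIsoPow k n z.1 x) (P := nonIsoPow k (n + 1) z.1 x)
        (mapFrom k F x z.2) (mapFrom_mem k F map_mem_rad n x z.2)
        (mapFrom_mem k F map_mem_rad (n + 1) x z.2)))
  /-- `⨁_{Fz = Fy} 𝒞(x, z) → Hom(Fx, Fy)` is injective -/
  injective_to : ∀ x y : C, Function.Injective
    (DirectSum.toModule k {z : C // F.obj z = F.obj y} (F.obj x ⟶ F.obj y)
      (fun z => mapTo k F x z.2))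
  /-- `⨁_{Fz = Fy} 𝒞(z, x) → Hom(Fy, Fx)` is injective -/
  injective_from : ∀ x y : C, Function.Injective
    (DirectSum.toModule k {z : C // F.obj z = F.obj y} (F.obj y ⟶ F.obj x)
      (fun z => mapFrom k F x z.2))
  irred_to_unique : ∀ (x : C), ∀ Y ∈ Γ, ∀ y y' : C, F.obj y = Y → F.obj y' = Y →
    (∃ f : x ⟶ y, IsIrred k f) → (∃ f : x ⟶ y', IsIrred k f) → y = y'
  irred_from_unique : ∀ X ∈ Γ, ∀ y x x' : C, F.obj x = X → F.obj x' = X →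
    (∃ f : x ⟶ y, IsIrred k f) → (∃ f : x' ⟶ y, IsIrred k f) → x = x'

/-- A direct sum decomposition `X = F x₁ ⊕ ⋯ ⊕ F x_r`, given by its injections and
projections. -/
structure Decomp (X : FGModuleCat.{u} A) where
  r : ℕ
  obj : Fin r → C
  inj : ∀ s, F.obj (obj s) ⟶ X
  proj : ∀ s, X ⟶ F.obj (obj s)
  inj_proj : ∀ s, inj s ≫ proj s = 𝟙 _
  inj_proj_ne : ∀ s t, s ≠ t → inj s ≫ proj t = 0
  sum_proj_inj : ∑ s, proj s ≫ inj s = 𝟙 X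

variable {F}

/-- `f : X ⟶ Y` is homogeneous with respect to decompositions `X = ⨁ F xₛ`, `Y = ⨁ F yₜ`: each
component is of the form `F φ` with `φ ∈ 𝒞(xₛ, yₜ)`. -/
def IsHomogeneousWrt {X Y : FGModuleCat.{u} A} (DX : Decomp F X) (DY : Decomp F Y)
    (f : X ⟶ Y) : Prop :=
  ∃ φ : ∀ s t, DX.obj s ⟶ DY.obj t, ∀ s t, DX.inj s ≫ f ≫ DY.proj t = F.map (φ s t)

/-- Homogeneous with respect to given decompositions, through morphisms `φ ∈ ℛᵈ` that are zero
whenever they lie in `ℛᵈ⁺¹`. -/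
def IsHomogeneousOfDegree (d : ℕ) {X Y : FGModuleCat.{u} A} (DX : Decomp F X) (DY : Decomp F Y)
    (f : X ⟶ Y) : Prop :=
  ∃ φ : ∀ s t, DX.obj s ⟶ DY.obj t,
    (∀ s t, φ s t ∈ nonIsoPow k d (DX.obj s) (DY.obj t)) ∧
    (∀ s t, φ s t ∈ nonIsoPow k (d + 1) (DX.obj s) (DY.obj t) → φ s t = 0) ∧
    ∀ s t, DX.inj s ≫ f ≫ DY.proj t = F.map (φ s t)

/-- `f'` is the homogeneous part of a morphism `f ∈ radᵈ` that is homogeneous up to `radᵈ⁺¹`,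
with respect to given decompositions. -/
def IsHomogeneousPart (d : ℕ) {X Y : FGModuleCat.{u} A} (DX : Decomp F X) (DY : Decomp F Y)
    (f f' : X ⟶ Y) : Prop :=
  f - f' ∈ radPow k (d + 1) X Y ∧ IsHomogeneousOfDegree k d DX DY f'

variable (F) in
/-- `f` is homogeneous up to `radᴺ`: the sum of a homogeneous morphism and one in `radᴺ`. -/
def IsHomogeneousUpTo (N : ℕ) {X Y : FGModuleCat.{u} A} (f : X ⟶ Y) : Prop :=
  ∃ g : X ⟶ Y, (∃ (DX : Decomp F X) (DY : Decomp F Y), IsHomogeneousWrt DX DY g) ∧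
    f - g ∈ radPow k N X Y

/-- Direct sum decompositions `Ker f' = (⨁_{m ≥ n} K⁽ᵐ⁾) ⊕ K⁽∞⁾` (as submodules of `X`, with
`K ⊤ = K⁽∞⁾`) and `K⁽ᵐ⁾ = ⨁ᵣ K⁽ᵐ⁾ᵣ` such that the `K⁽ᵐ⁾ᵣ` are indecomposable, their inclusion into
`X` lies in `radᵐ ∖ radᵐ⁺¹` and is homogeneous (of degree `m`) with respect to the given
decomposition of `X`, and the inclusion of `K⁽∞⁾` lies in the intersection of all `radᴺ`. -/
structure KernelDecomp [FiniteDimensional k A] {X Y : FGModuleCat.{u} A} (DX : Decomp F X)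
    (f' : X ⟶ Y) (n : ℕ) where
  K : ℕ∞ → Submodule A X
  indep : iSupIndep K
  iSup_eq : ⨆ m, K m = LinearMap.ker f'.hom.hom
  eq_bot : ∀ m : ℕ, m < n → K m = ⊥
  r : ℕ → ℕ
  Kr : ∀ m : ℕ, Fin (r m) → Submodule A X
  indep_Kr : ∀ m : ℕ, iSupIndep (Kr m)
  iSup_Kr : ∀ m : ℕ, ⨆ s, Kr m s = K m
  indec : ∀ m s, IsIndec (subObj k (Kr m s))
  incl_top_mem : subIncl k (K ⊤) ∈ ⨅ N : ℕ, radPow k N (subObj k (K ⊤)) X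
  incl_mem : ∀ m : ℕ, subIncl k (K m) ∈ radPow k m (subObj k (K m)) X
  incl_Kr_mem : ∀ m s, subIncl k (Kr m s) ∈ radPow k m (subObj k (Kr m s)) X
  incl_Kr_not_mem : ∀ m s, subIncl k (Kr m s) ∉ radPow k (m + 1) (subObj k (Kr m s)) X
  homogeneous : ∀ m s, ∃ DK : Decomp F (subObj k (Kr m s)),
    IsHomogeneousOfDegree k m DK DX (subIncl k (Kr m s))

/-- The map `⨁_{n ≤ m ≤ ℓ} radˡ⁻ᵐ/radˡ⁻ᵐ⁺¹(Z, K⁽ᵐ⁾) → radˡ/radˡ⁺¹(Z, X)` induced by the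
inclusions `K⁽ᵐ⁾ ⟶ X`. -/
def KernelDecomp.inclMap [FiniteDimensional k A] {X Y : FGModuleCat.{u} A} {DX : Decomp F X}
    {f' : X ⟶ Y} {n : ℕ} (E : KernelDecomp k DX f' n) (l : ℕ) (Z : FGModuleCat.{u} A) :
    (⨁ m : Finset.Icc n l, RadGr k (l - m.1) Z (subObj k (E.K (m.1 : ℕ∞)))) →ₗ[k] RadGr k l Z X :=
  DirectSum.toModule k _ _ (fun m => radGrComp k Z (subIncl k (E.K (m.1 : ℕ∞))) (E.incl_mem m.1)
    (Nat.sub_add_cancel (Finset.mem_Icc.1 m.2).2))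

end Covering

end RadDegree

end

open RadDegree

noncomputable section

namespace RadDegree

/-! ### Powers of ideals -/

section IdealPowers

variable (k : Type w) [Field k] {D : Type u'} [Category.{v'} D] [Preadditive D] [Linear k D]

/-! The radical filtration of `Hom(W, X)` has in general no grading; the covering functor supplies
one when `W` is indecomposable and `X` is a sum of modules `F x`, and the homogeneous part `f'`
respects it.

In a category with length, a path of length `n` from `x` to `y` forces `ℛⁿ⁺¹(x, y) = 0`, and in the
absence of such a path `ℛⁿ(x, y) = ℛⁿ⁺¹(x, y)`. Hence `degPart` is a complement of `ℛᵈ⁺¹` in `ℛᵈ`,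
and these complements multiply: degrees add. By the second bijection of the covering property, if `W
≅ F y` then the images of `degPart m z x`, for all `z` with `F z = F y`, are independent subspaces
of `radᵐ(W, F x)` that together complement `radᵐ⁺¹(W, F x)`. If `W` is not isomorphic to a module of
`Γ`, all layers vanish and there is nothing to grade. This is the content of `SourceGrading`.

Composition with `f'` sends degree `m` to degree `m + d` and keeps the index `z`. So if `g ∈ radᵐ(W,
X)` and `g ≫ f' ∈ radᵐ⁺ᵈ⁺¹`, the leading term `a` of `g` satisfies `a ≫ f' = 0` exactly, because a
homogeneous element that drops in the filtration is zero (`exists_part_comp_eq_zero`). Kernels on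
the layers thus come from true factorisations through `Ker f'`. Since `f` and `f'` agree modulo
`radᵈ⁺¹`, they act alike on the layers, which links `Ker f'` with the left degree of `f`.

To decompose `Ker f'`, take leading terms repeatedly: every `g` with `g ≫ f' = 0` is a sum of
homogeneous morphisms with a single index and a morphism in `rad^∞`, all killed by `f'`
(`mem_span_of_comp_eq_zero`). Indecomposable modules have local endomorphism rings, so in a
decomposition of the kernel into indecomposables each injection can be exchanged for a morphism of
one of these kinds (`SumData.exists_inj_mem`). Grouping the summands by degree gives the `K⁽ᵐ⁾`. For
the exact sequence, `mem_radPow_of_sum_mem` shows degree by degree that no cancellation occurs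
between different `K⁽ᵐ⁾`: the leading terms of a cancelling sum would add up to zero in `X`, hence
all vanish since the sum of the `K⁽ᵐ⁾` is direct. -/

theorem idealPow_comp {I : ∀ X Y : D, Submodule k (X ⟶ Y)}
    (hI : ∀ {X Y Z : D} {f : X ⟶ Y}, f ∈ I X Y → ∀ g : Y ⟶ Z, f ≫ g ∈ I X Z)
    {n : ℕ} {X Y Z : D} {f : X ⟶ Y} (hf : f ∈ idealPow k I n X Y) (g : Y ⟶ Z) :
    f ≫ g ∈ idealPow k I n X Z := by
  cases n with
  | zero => exact Submodule.mem_top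
  | succ n =>
    have : idealPow k I (n + 1) X Y ≤ (idealPow k I (n + 1) X Z).comap (Linear.rightComp k X g) :=
      Submodule.span_le.2 (by
        rintro _ ⟨W, a, b, ha, hb, rfl⟩
        exact Submodule.subset_span ⟨W, a, b ≫ g, ha, hI hb g, by simp⟩)
    exact this hf

theorem idealPow_comp_idealPow {I : ∀ X Y : D, Submodule k (X ⟶ Y)}
    (hI : ∀ {X Y Z : D} {f : X ⟶ Y}, f ∈ I X Y → ∀ g : Y ⟶ Z, f ≫ g ∈ I X Z)
    {a b : ℕ} {X Y Z : D} {f : X ⟶ Y} {g : Y ⟶ Z}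
    (hf : f ∈ idealPow k I a X Y) (hg : g ∈ idealPow k I b Y Z) :
    f ≫ g ∈ idealPow k I (a + b) X Z := by
  induction b generalizing Z with
  | zero => exact idealPow_comp k hI hf g
  | succ b ih =>
    have : idealPow k I (b + 1) Y Z ≤
        (idealPow k I (a + (b + 1)) X Z).comap (Linear.leftComp k Z f) :=
      Submodule.span_le.2 (by
        rintro _ ⟨W, p, q, hp, hq, rfl⟩
        exact Submodule.subset_span ⟨W, f ≫ p, q, ih hp, hq, by simp⟩)
    exact this hg

theorem comp_idealPow {I : ∀ X Y : D, Submodule k (X ⟶ Y)}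
    (hI : ∀ {X Y Z : D} {f : X ⟶ Y}, f ∈ I X Y → ∀ g : Y ⟶ Z, f ≫ g ∈ I X Z)
    {n : ℕ} {X Y Z : D} (f : X ⟶ Y) {g : Y ⟶ Z} (hg : g ∈ idealPow k I n Y Z) :
    f ≫ g ∈ idealPow k I n X Z := by
  simpa using idealPow_comp_idealPow k hI (a := 0) (f := f) Submodule.mem_top hg

theorem idealPow_antitone {I : ∀ X Y : D, Submodule k (X ⟶ Y)}
    (hI : ∀ {X Y Z : D} {f : X ⟶ Y}, f ∈ I X Y → ∀ g : Y ⟶ Z, f ≫ g ∈ I X Z) (X Y : D) :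
    Antitone fun n => idealPow k I n X Y := by
  refine antitone_nat_of_succ_le fun n => Submodule.span_le.2 ?_
  rintro _ ⟨W, a, b, ha, hb, rfl⟩
  exact idealPow_comp k hI ha b

theorem radPow_antitone (X Y : D) : Antitone fun n => radPow k n X Y :=
  idealPow_antitone k (catRad_comp k) X Y

theorem comp_radPow {n : ℕ} {X Y Z : D} (f : X ⟶ Y) {g : Y ⟶ Z} (hg : g ∈ radPow k n Y Z) :
    f ≫ g ∈ radPow k n X Z :=
  comp_idealPow k (catRad_comp k) f hg

theorem mem_idealPow_one {I : ∀ X Y : D, Submodule k (X ⟶ Y)} {X Y : D} {f : X ⟶ Y}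
    (hf : f ∈ I X Y) : f ∈ idealPow k I 1 X Y :=
  Submodule.subset_span ⟨X, 𝟙 X, f, Submodule.mem_top, hf, by simp⟩

/-- The definition of `catRad` gives closure under postcomposition at once; closure under
precomposition comes from the symmetry between `𝟙 - f ≫ g` and `𝟙 - g ≫ f`. -/
theorem mem_radPow_one_iff {X Y : D} {f : X ⟶ Y} : f ∈ radPow k 1 X Y ↔ f ∈ catRad k X Y := by
  refine ⟨fun hf => ?_, mem_idealPow_one k⟩
  refine (Submodule.span_le (p := catRad k X Y)).2 ?_ hf
  rintro _ ⟨W, a, b, -, hb, rfl⟩ g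
  have := hb (g ≫ a)
  rw [← Category.assoc] at this
  simpa using isIso_one_sub_swap _ _ this

end IdealPowers

/-! ### Categories with length -/

section Length

variable {k : Type w} [Field k] {C : Type u'} [Category.{v'} C] [Preadditive C] [Linear k C]

namespace IsWithLength

variable (hC : IsWithLength k C)
include hC

theorem nonIso_comp {x y z : C} {f : x ⟶ y} (hf : f ∈ nonIso k x y) (g : y ⟶ z) :
    f ≫ g ∈ nonIso k x z := by
  have : nonIso k x y ≤ (nonIso k x z).comap (Linear.rightComp k x g) :=
    Submodule.span_le.2 fun a ha => Submodule.subset_span (hC.not_isIso_comp_right a g ha)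
  exact this hf

theorem nonIsoPow_antitone (x y : C) : Antitone fun n => nonIsoPow k n x y :=
  idealPow_antitone k hC.nonIso_comp x y

theorem comp_mem {a b : ℕ} {x y z : C} {f : x ⟶ y} {g : y ⟶ z}
    (hf : f ∈ nonIsoPow k a x y) (hg : g ∈ nonIsoPow k b y z) :
    f ≫ g ∈ nonIsoPow k (a + b) x z :=
  idealPow_comp_idealPow k hC.nonIso_comp hf hg

/-- In a product `a ≫ b` with `a ∈ ℛⁿ` and `b ∈ ℛ`, either there is no path of length `n` for `a`
and induction raises its exponent, or `b` is not irreducible and lies in `ℛ²`; otherwise `b` would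
extend a path. -/
theorem nonIsoPow_le_of_not_hasPath {n : ℕ} {x y : C} (h : ¬ HasPath k x y n) :
    nonIsoPow k n x y ≤ nonIsoPow k (n + 1) x y := by
  induction n generalizing y with
  | zero =>
    intro f _
    refine mem_idealPow_one k (Submodule.subset_span fun hf => h ?_)
    obtain rfl := hC.skeletal ⟨asIso f⟩
    exact HasPath.nil x
  | succ n ih =>
    refine Submodule.span_le.2 ?_
    rintro _ ⟨z, a, b, ha, hb, rfl⟩
    by_cases hp : HasPath k x z n
    · have hb1 : b ∈ nonIsoPow k 1 z y := mem_idealPow_one k hb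
      by_cases hb2 : b ∈ nonIsoPow k 2 z y
      · exact hC.comp_mem (a := n) (b := 2) ha hb2
      · exact (h (HasPath.cons b ⟨hb1, hb2⟩ hp)).elim
    · exact hC.comp_mem (ih hp ha) (mem_idealPow_one k hb)

/-- Paths of any length other than `n` are excluded, so the powers are constant from `n + 1` on and
equal their intersection, which is zero. -/
theorem nonIsoPow_succ_eq_bot {n : ℕ} {x y : C} (h : HasPath k x y n) :
    nonIsoPow k (n + 1) x y = ⊥ := by
  rw [eq_bot_iff, ← hC.iInf_eq_bot x y]
  refine le_iInf fun m => ?_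
  rcases le_total m (n + 1) with hm | hm
  · exact hC.nonIsoPow_antitone x y hm
  · induction m, hm using Nat.le_induction with
    | base => exact le_rfl
    | succ m hm ih =>
      refine ih.trans (hC.nonIsoPow_le_of_not_hasPath fun h' => ?_)
      have := hC.length_unique h h'
      omega

theorem hasPath_of_not_mem {n : ℕ} {x y : C} {f : x ⟶ y} (hf : f ∈ nonIsoPow k n x y)
    (hf' : f ∉ nonIsoPow k (n + 1) x y) : HasPath k x y n :=
  not_not.1 fun h => hf' (hC.nonIsoPow_le_of_not_hasPath h hf)

end IsWithLength

theorem HasPath.trans {x y z : C} {m n : ℕ} (h : HasPath k x y m) (h' : HasPath k y z n) :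
    HasPath k x z (m + n) := by
  induction h' with
  | nil => exact h
  | cons f hf _ ih => exact HasPath.cons f hf ih

/-- The homogeneous morphisms of degree `d` of a category with length: those in `ℛᵈ` which are
zero if they lie in `ℛᵈ⁺¹`. -/
def degPart (hC : IsWithLength k C) (d : ℕ) (x y : C) : Submodule k (x ⟶ y) where
  carrier := {φ | φ ∈ nonIsoPow k d x y ∧ (φ ∈ nonIsoPow k (d + 1) x y → φ = 0)}
  zero_mem' := ⟨Submodule.zero_mem _, fun _ => rfl⟩
  add_mem' := by
    rintro a b ⟨ha, ha'⟩ ⟨hb, hb'⟩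
    refine ⟨Submodule.add_mem _ ha hb, fun h => ?_⟩
    -- If `a ∉ ℛᵈ⁺¹`, a path of length `d` exists and `ℛᵈ⁺¹(x, y) = 0`.
    by_cases h0 : a ∈ nonIsoPow k (d + 1) x y
    · rw [ha' h0, zero_add] at h ⊢
      exact hb' h
    · rw [hC.nonIsoPow_succ_eq_bot (hC.hasPath_of_not_mem ha h0)] at h
      exact h
  smul_mem' := by
    rintro c a ⟨ha, ha'⟩
    refine ⟨Submodule.smul_mem _ c ha, fun h => ?_⟩
    by_cases h0 : c = 0
    · simp [h0]
    · rw [ha' ((Submodule.smul_mem_iff _ h0).1 h), smul_zero]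

/-- Two nonzero factors come with paths of lengths `a` and `b`; the concatenated path makes
`ℛᵃ⁺ᵇ⁺¹(x, z)` zero. -/
theorem comp_mem_degPart (hC : IsWithLength k C) {a b : ℕ} {x y z : C} {φ : x ⟶ y} {ψ : y ⟶ z}
    (hφ : φ ∈ degPart hC a x y) (hψ : ψ ∈ degPart hC b y z) :
    φ ≫ ψ ∈ degPart hC (a + b) x z := by
  by_cases h0 : φ ∈ nonIsoPow k (a + 1) x y
  · rw [hφ.2 h0, Limits.zero_comp]
    exact Submodule.zero_mem _
  by_cases h1 : ψ ∈ nonIsoPow k (b + 1) y z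
  · rw [hψ.2 h1, Limits.comp_zero]
    exact Submodule.zero_mem _
  refine ⟨hC.comp_mem hφ.1 hψ.1, fun h => ?_⟩
  rw [hC.nonIsoPow_succ_eq_bot
    ((hC.hasPath_of_not_mem hφ.1 h0).trans (hC.hasPath_of_not_mem hψ.1 h1))] at h
  exact h

theorem exists_degPart_sub_mem (hC : IsWithLength k C) {d : ℕ} {x y : C} {φ : x ⟶ y}
    (hφ : φ ∈ nonIsoPow k d x y) :
    ∃ ψ ∈ degPart hC d x y, φ - ψ ∈ nonIsoPow k (d + 1) x y := by
  by_cases h : φ ∈ nonIsoPow k (d + 1) x y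
  · exact ⟨0, Submodule.zero_mem _, by simpa using h⟩
  · exact ⟨φ, ⟨hφ, fun h' => (h h').elim⟩, by simp⟩

end Length

/-! ### Finite direct sum decompositions in a preadditive category -/

section SumData

variable {D : Type u'} [Category.{v'} D] [Preadditive D]

open Classical in
/-- The injections and projections of a finite direct sum decomposition `X = ⨁ W i`. -/
structure SumData (ι : Type*) [Fintype ι] (X : D) (W : ι → D) where
  inj : ∀ i, W i ⟶ X
  proj : ∀ i, X ⟶ W i
  inj_proj : ∀ i, inj i ≫ proj i = 𝟙 _
  inj_proj_ne : ∀ i j, i ≠ j → inj i ≫ proj j = 0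
  sum_proj_inj : ∑ i, proj i ≫ inj i = 𝟙 X

namespace SumData

variable {ι : Type*} [Fintype ι] {X : D} {W : ι → D}

/-- A decomposition with a single summand. -/
def ofIso {W : D} (e : W ≅ X) : SumData Unit X fun _ => W where
  inj _ := e.hom
  proj _ := e.inv
  inj_proj _ := e.hom_inv_id
  inj_proj_ne _ _ h := (h rfl).elim
  sum_proj_inj := by simp

/-- Transport of a decomposition along an isomorphism. -/
def congr (B : SumData ι X W) {Y : D} (e : X ≅ Y) : SumData ι Y W where
  inj i := B.inj i ≫ e.hom
  proj i := e.inv ≫ B.proj i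
  inj_proj i := by simp [B.inj_proj]
  inj_proj_ne i j h := by simp [B.inj_proj_ne i j h]
  sum_proj_inj := by
    have : ∑ i, e.inv ≫ (B.proj i ≫ B.inj i) ≫ e.hom = 𝟙 Y := by
      rw [← Preadditive.comp_sum, ← Preadditive.sum_comp, B.sum_proj_inj]
      simp
    simpa using this

/-- Refinement of a decomposition. -/
def sigma (B : SumData ι X W) {κ : ι → Type*} [∀ i, Fintype (κ i)] {V : ∀ i, κ i → D}
    (E : ∀ i, SumData (κ i) (W i) (V i)) :
    SumData (Σ i, κ i) X fun p => V p.1 p.2 where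
  inj p := (E p.1).inj p.2 ≫ B.inj p.1
  proj p := B.proj p.1 ≫ (E p.1).proj p.2
  inj_proj p := by
    rw [Category.assoc, ← Category.assoc (B.inj _), B.inj_proj, Category.id_comp, (E p.1).inj_proj]
  inj_proj_ne := by
    rintro ⟨i, a⟩ ⟨j, b⟩ h
    rw [Category.assoc, ← Category.assoc (B.inj _)]
    by_cases hij : i = j
    · subst hij
      rw [B.inj_proj, Category.id_comp]
      exact (E i).inj_proj_ne a b fun hab => h (by rw [hab])
    · rw [B.inj_proj_ne i j hij]
      simp
  sum_proj_inj := by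
    rw [Fintype.sum_sigma, ← B.sum_proj_inj]
    refine Finset.sum_congr rfl fun i _ => ?_
    have : ∑ a, B.proj i ≫ ((E i).proj a ≫ (E i).inj a) ≫ B.inj i = B.proj i ≫ B.inj i := by
      rw [← Preadditive.comp_sum, ← Preadditive.sum_comp, (E i).sum_proj_inj]
      simp
    simpa using this

/-- Reindexing of a decomposition. -/
def reindex (B : SumData ι X W) {κ : Type*} [Fintype κ] (e : κ ≃ ι) :
    SumData κ X fun i => W (e i) where
  inj i := B.inj (e i)
  proj i := B.proj (e i)
  inj_proj _ := B.inj_proj _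
  inj_proj_ne _ _ h := B.inj_proj_ne _ _ (e.injective.ne h)
  sum_proj_inj := (e.sum_comp fun i => B.proj i ≫ B.inj i).trans B.sum_proj_inj

/-- With `θ` inverse to `v ≫ B.proj j`, the idempotent `B.proj j ≫ θ ≫ v` has the image of `v` as
image and the sum of the other summands as kernel. The other projections are corrected by its
complement. -/
theorem exists_replace (B : SumData ι X W) (j : ι) (v : W j ⟶ X) [hv : IsIso (v ≫ B.proj j)] :
    ∃ B' : SumData ι X W, B'.inj j = v ∧ ∀ i, i ≠ j → B'.inj i = B.inj i := by
  classical
  set θ := inv (v ≫ B.proj j) with hθ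
  have h1 : v ≫ B.proj j ≫ θ = 𝟙 _ := by rw [← Category.assoc, hθ, IsIso.hom_inv_id]
  have h1' : ∀ {Z : D} (a : W j ⟶ Z), v ≫ B.proj j ≫ θ ≫ a = a := fun a => by
    have := congrArg (· ≫ a) h1
    simpa using this
  have h2 : ∀ {Z : D} (a : W j ⟶ Z), θ ≫ v ≫ B.proj j ≫ a = a := fun a => by
    rw [← Category.assoc v, hθ, IsIso.inv_hom_id_assoc]
  refine ⟨{ inj := fun i => if h : i = j then eqToHom (by rw [h]) ≫ v else B.inj i
            proj := fun i => if h : i = j then B.proj j ≫ θ ≫ eqToHom (by rw [h]) else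
              B.proj i - B.proj j ≫ θ ≫ v ≫ B.proj i
            inj_proj := ?_
            inj_proj_ne := ?_
            sum_proj_inj := ?_ }, by simp, fun i hi => by simp [hi]⟩
  · intro i
    by_cases h : i = j
    · subst h
      simp [h1]
    · have : B.inj i ≫ B.proj j ≫ θ ≫ v ≫ B.proj i = 0 := by
        rw [← Category.assoc (B.inj i), B.inj_proj_ne i j h, Limits.zero_comp]
      simp [h, this, B.inj_proj]
  · intro i l hil
    by_cases h : i = j
    · subst h
      have hl : l ≠ i := hil.symm
      simp [hl, h1']
    · have h0 : ∀ {Z : D} (a : W j ⟶ Z), B.inj i ≫ B.proj j ≫ a = 0 := fun a => by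
        rw [← Category.assoc (B.inj i), B.inj_proj_ne i j h, Limits.zero_comp]
      by_cases hl : l = j
      · subst hl
        simp [h, h0]
      · simp [h, hl, h0, B.inj_proj_ne i l hil]
  · have hs : ∀ i ∈ Finset.univ.erase j,
        (if h : i = j then B.proj j ≫ θ ≫ eqToHom (by rw [h]) else
          B.proj i - B.proj j ≫ θ ≫ v ≫ B.proj i) ≫
          (if h : i = j then eqToHom (by rw [h]) ≫ v else B.inj i) =
        B.proj i ≫ B.inj i - (B.proj j ≫ θ ≫ v) ≫ B.proj i ≫ B.inj i := by
      intro i hi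
      have h := (Finset.mem_erase.1 hi).1
      simp [h]
    have hsum : ∑ i ∈ Finset.univ.erase j, B.proj i ≫ B.inj i = 𝟙 X - B.proj j ≫ B.inj j := by
      rw [eq_sub_iff_add_eq, Finset.sum_erase_add _ _ (Finset.mem_univ j), B.sum_proj_inj]
    rw [← Finset.sum_erase_add _ _ (Finset.mem_univ j), Finset.sum_congr rfl hs,
      Finset.sum_sub_distrib, ← Preadditive.comp_sum, hsum]
    simp [h2]

end SumData

end SumData

/-! ### Indecomposable modules -/

section Modules

variable {A : Type u} [Ring A]

/-- A linear map, as a morphism of finitely generated modules. -/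
def homOfLin {X Y : FGModuleCat.{u} A} (φ : X →ₗ[A] Y) : X ⟶ Y := ⟨ModuleCat.ofHom φ⟩

theorem isIso_iff_bijective_hom {X Y : FGModuleCat.{u} A} (f : X ⟶ Y) :
    IsIso f ↔ Function.Bijective f.hom.hom := by
  constructor
  · intro h
    exact (FGModuleCat.isoToLinearEquiv (asIso f)).bijective
  · intro h
    refine ⟨homOfLin (LinearEquiv.ofBijective f.hom.hom h).symm.toLinearMap, ?_, ?_⟩
    · ext x
      exact (LinearEquiv.ofBijective f.hom.hom h).symm_apply_apply x
    · ext x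
      exact (LinearEquiv.ofBijective f.hom.hom h).apply_symm_apply x

@[simp]
theorem hom_hom_sum {ι : Type*} (s : Finset ι) {X Y : FGModuleCat.{u} A} (f : ι → (X ⟶ Y)) :
    (∑ i ∈ s, f i).hom.hom = ∑ i ∈ s, (f i).hom.hom :=
  map_sum (⟨⟨fun f => f.hom.hom, rfl⟩, fun _ _ => rfl⟩ : (X ⟶ Y) →+ (X →ₗ[A] Y)) f s

theorem id_ne_zero_of_nontrivial (X : FGModuleCat.{u} A) [Nontrivial X] : 𝟙 X ≠ 0 := by
  intro h
  obtain ⟨x, hx⟩ := exists_ne (0 : X)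
  exact hx (congrArg (fun f : X ⟶ X => f.hom.hom x) h)

theorem IsIndec.of_iso {X Y : FGModuleCat.{u} A} (e : X ≅ Y) (h : IsIndec X) : IsIndec Y := by
  let e' := FGModuleCat.isoToLinearEquiv e
  obtain ⟨h1, h2⟩ := h
  refine ⟨e'.symm.toEquiv.nontrivial, fun p q hpq => ?_⟩
  have := (Submodule.orderIsoMapComap e'.symm).isCompl hpq
  rcases h2 _ _ this with h | h
  · left
    exact (map_eq_bot_iff (Submodule.orderIsoMapComap e'.symm)).1 h
  · right
    exact (map_eq_bot_iff (Submodule.orderIsoMapComap e'.symm)).1 h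

theorem IsIndec.eq_zero_or_eq_id {X : FGModuleCat.{u} A} (hX : IsIndec X) {e : X ⟶ X}
    (he : e ≫ e = e) : e = 0 ∨ e = 𝟙 X := by
  have hid : IsIdempotentElem (e.hom.hom : Module.End A X) :=
    congrArg (fun f : X ⟶ X => f.hom.hom) he
  have hx : ∀ x, e.hom.hom (e.hom.hom x) = e.hom.hom x := fun x =>
    congrArg (fun f : X ⟶ X => f.hom.hom x) he
  rcases hX.2 _ _ (LinearMap.IsIdempotentElem.isCompl hid) with h | h
  · left
    ext x
    exact LinearMap.congr_fun (LinearMap.range_eq_bot.1 h) x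
  · right
    ext x
    exact LinearMap.ker_eq_bot.1 h (hx x)

/-- The endomorphism `b ≫ inv (a ≫ b) ≫ a` of `X` is idempotent, and it cannot be zero because `W`
is nonzero. -/
theorem IsIndec.isIso_of_comp {W X : FGModuleCat.{u} A} (hW : IsIndec W) (hX : IsIndec X)
    (a : W ⟶ X) (b : X ⟶ W) (h : IsIso (a ≫ b)) : IsIso a := by
  have h1 : a ≫ b ≫ inv (a ≫ b) = 𝟙 W := by rw [← Category.assoc, IsIso.hom_inv_id]
  have h1' : ∀ {Z : FGModuleCat.{u} A} (c : W ⟶ Z), a ≫ b ≫ inv (a ≫ b) ≫ c = c := fun c => by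
    have := congrArg (· ≫ c) h1
    simpa only [Category.assoc, Category.id_comp] using this
  rcases hX.eq_zero_or_eq_id (e := b ≫ inv (a ≫ b) ≫ a)
    (by simp only [Category.assoc, h1']) with h | h
  · have := hW.1
    refine (id_ne_zero_of_nontrivial W ?_).elim
    have := congrArg (fun t => a ≫ t ≫ b ≫ inv (a ≫ b)) h
    simpa only [Category.assoc, h1', Limits.zero_comp, Limits.comp_zero, h1] using this
  · exact ⟨b ≫ inv (a ≫ b), h1, by simpa only [Category.assoc] using h⟩

/-- Fitting's lemma: kernel and range of a high power of `f` are complementary, so `f` is injective,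
hence bijective, or nilpotent. -/
theorem IsIndec.isIso_or (k : Type w) [Field k] [Algebra k A] [FiniteDimensional k A]
    {X : FGModuleCat.{u} A} (hX : IsIndec X) (f : X ⟶ X) :
    IsIso f ∨ IsIso (𝟙 X - f) := by
  have : IsArtinianRing A := isArtinian_of_tower k inferInstance
  have : IsNoetherianRing A := isNoetherian_of_tower k inferInstance
  let φ : Module.End A X := f.hom.hom
  obtain ⟨n, hn⟩ := Filter.eventually_atTop.1 (LinearMap.eventually_isCompl_ker_pow_range_pow φ)
  rcases hX.2 _ _ (hn (n + 1) (Nat.le_succ n)) with h | h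
  · left
    rw [isIso_iff_bijective_hom]
    have hinj : Function.Injective φ := by
      rw [LinearMap.ker_eq_bot, pow_succ] at h
      exact Function.Injective.of_comp (f := ⇑(φ ^ n)) h
    exact IsArtinian.bijective_of_injective_endomorphism φ hinj
  · right
    rw [LinearMap.range_eq_bot] at h
    have : IsUnit (1 - φ) := IsNilpotent.isUnit_one_sub ⟨n + 1, h⟩
    rw [isIso_iff_bijective_hom]
    exact (Module.End.isUnit_iff _).1 this

variable {k : Type w} [Field k] [Algebra k A]

variable (k) in
theorem id_not_mem_catRad (X : FGModuleCat.{u} A) [Nontrivial X] : 𝟙 X ∉ catRad k X X := by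
  intro h
  have h0 := h (𝟙 X)
  rw [Category.comp_id, sub_self] at h0
  apply id_ne_zero_of_nontrivial X
  rw [← IsIso.hom_inv_id (0 : X ⟶ X), Limits.zero_comp]

variable [FiniteDimensional k A]

theorem IsIndec.isIso_of_not_mem_catRad {W X : FGModuleCat.{u} A} (hW : IsIndec W)
    (hX : IsIndec X) {f : W ⟶ X} (hf : f ∉ catRad k W X) : IsIso f := by
  have : ¬ ∀ g : X ⟶ W, IsIso (𝟙 W - f ≫ g) := hf
  push Not at this
  obtain ⟨g, hg⟩ := this
  exact hW.isIso_of_comp hX f g ((hW.isIso_or k (f ≫ g)).resolve_right hg)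

/-! ### Submodules as objects -/

instance mono_subIncl {X : FGModuleCat.{u} A} (S : Submodule A X) : Mono (subIncl k S) := by
  refine ⟨fun g h hgh => ?_⟩
  ext x
  exact Subtype.ext (congrArg (fun f : _ ⟶ X => f.hom.hom x) hgh)

variable (k) in
/-- The factorisation of a morphism through a submodule containing its image. -/
def liftSub {Z X : FGModuleCat.{u} A} (S : Submodule A X) (g : Z ⟶ X)
    (hg : ∀ z, g.hom.hom z ∈ S) : Z ⟶ subObj k S :=
  homOfLin (Y := subObj k S) (LinearMap.codRestrict S g.hom.hom hg)

@[simp]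
theorem liftSub_comp {Z X : FGModuleCat.{u} A} (S : Submodule A X) (g : Z ⟶ X)
    (hg : ∀ z, g.hom.hom z ∈ S) : liftSub k S g hg ≫ subIncl k S = g := rfl

variable (k) in
/-- The inclusion between two submodules. -/
def subLE {X : FGModuleCat.{u} A} {S T : Submodule A X} (h : S ≤ T) : subObj k S ⟶ subObj k T :=
  liftSub k T (subIncl k S) fun z => h z.2

@[simp]
theorem subLE_comp {X : FGModuleCat.{u} A} {S T : Submodule A X} (h : S ≤ T) :
    subLE k h ≫ subIncl k T = subIncl k S := rfl

theorem comp_subIncl_mem {Z X : FGModuleCat.{u} A} (S : Submodule A X) (g : Z ⟶ subObj k S)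
    (z : Z) : (g ≫ subIncl k S).hom.hom z ∈ S := (g.hom.hom z).2

variable (k) in
theorem nonempty_sumData_of_iSupIndep {ι : Type*} [Fintype ι] {X : FGModuleCat.{u} A}
    {L : ι → Submodule A X} (hL : iSupIndep L) {S : Submodule A X} (hS : ⨆ i, L i = S) :
    ∃ B : SumData ι (subObj k S) fun i => subObj k (L i),
      ∀ i, B.inj i ≫ subIncl k S = subIncl k (L i) := by
  classical
  have hle : ∀ i, L i ≤ S := fun i => hS ▸ le_iSup L i
  let φ : (∀ i, L i) →ₗ[A] S :=
    ∑ i, (Submodule.inclusion (hle i)).comp (LinearMap.proj i)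
  have hφ : ∀ v, (φ v : X) = ∑ i, (v i : X) := fun v => by simp [φ]
  have hinj : Function.Injective φ := by
    rw [injective_iff_map_eq_zero]
    intro v hv
    have h0 : ∑ i, (v i : X) = 0 := by rw [← hφ, hv]; rfl
    have := (iSupIndep_iff_finsetSum_eq_zero_imp_eq_zero L).1 hL Finset.univ (fun i => (v i : X))
      (fun i _ => (v i).2) h0
    funext i
    exact Subtype.ext (this i (Finset.mem_univ i))
  have hsurj : Function.Surjective φ := by
    rintro ⟨x, hx⟩
    obtain ⟨f, hf, hfx⟩ := (Submodule.mem_iSup_iff_exists_finsupp L x).1 (hS ▸ hx)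
    refine ⟨fun i => ⟨f i, hf i⟩, Subtype.ext ?_⟩
    rw [hφ]
    exact (Finsupp.sum_fintype _ _ (fun _ => rfl)).symm.trans hfx
  let e := LinearEquiv.ofBijective φ ⟨hinj, hsurj⟩
  have he : ∀ i (x : L i), e.symm (Submodule.inclusion (hle i) x) = Pi.single i x := by
    intro i x
    rw [LinearEquiv.symm_apply_eq]
    refine Subtype.ext ?_
    change (x : X) = (φ (Pi.single i x) : X)
    rw [hφ, Finset.sum_eq_single i]
    · simp
    · intro j _ hj
      simp [Pi.single_eq_of_ne hj]
    · simp
  refine ⟨{ inj := fun i => subLE k (hle i)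
            proj := fun i => homOfLin (X := subObj k S) (Y := subObj k (L i))
              ((LinearMap.proj i).comp e.symm.toLinearMap)
            inj_proj := ?_
            inj_proj_ne := ?_
            sum_proj_inj := ?_ }, fun i => subLE_comp (hle i)⟩
  · intro i
    ext x
    exact (congrFun (he i x) i).trans (Pi.single_eq_same i _)
  · intro i j hij
    ext x
    exact (congrFun (he i x) j).trans (Pi.single_eq_of_ne hij.symm _)
  · rw [← cancel_mono (subIncl k S), Preadditive.sum_comp]
    ext x
    rw [hom_hom_sum, LinearMap.sum_apply]
    exact (hφ (e.symm x)).symm.trans (congrArg Subtype.val (e.apply_symm_apply x))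

variable (k) in
-- The index set may be infinite (it is `ℕ∞` for the kernel), but `X` is noetherian, so only
-- finitely many `L i` are nonzero.
theorem exists_sum_comp_subIncl {ι : Type*} {Z X : FGModuleCat.{u} A}
    {L : ι → Submodule A X} (hL : iSupIndep L) (g : Z ⟶ X)
    (hg : ∀ z, g.hom.hom z ∈ ⨆ i, L i) :
    ∃ (T : Finset ι) (h : ∀ i, Z ⟶ subObj k (L i)), g = ∑ i ∈ T, h i ≫ subIncl k (L i) := by
  classical
  have : IsNoetherianRing A := isNoetherian_of_tower k inferInstance
  have hfin : {i | L i ≠ ⊥}.Finite := WellFoundedGT.finite_ne_bot_of_iSupIndep hL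
  set T := hfin.toFinset with hT
  have hsup : ⨆ i : T, L i = ⨆ i, L i := by
    refine le_antisymm (iSup_le fun i => le_iSup L i) (iSup_le fun i => ?_)
    by_cases hi : L i = ⊥
    · simp [hi]
    · exact le_iSup (fun i : T => L i) ⟨i, by simpa [hT] using hi⟩
  obtain ⟨B, hB⟩ := nonempty_sumData_of_iSupIndep k (hL.comp (f := fun i : T => (i : ι))
    Subtype.val_injective) hsup
  refine ⟨T, fun i => if hi : i ∈ T then liftSub k _ g hg ≫ B.proj ⟨i, hi⟩ else 0, ?_⟩
  have h1 : g = liftSub k _ g hg ≫ (∑ i, B.proj i ≫ B.inj i) ≫ subIncl k _ := by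
    rw [B.sum_proj_inj, Category.id_comp, liftSub_comp]
  rw [← Finset.sum_coe_sort T]
  refine h1.trans ?_
  rw [Preadditive.sum_comp, Preadditive.comp_sum]
  refine Finset.sum_congr rfl fun i _ => ?_
  simp [hB]

theorem eq_zero_of_sum_comp_subIncl {ι : Type*} {Z X : FGModuleCat.{u} A}
    {L : ι → Submodule A X} (hL : iSupIndep L) (T : Finset ι) (h : ∀ i, Z ⟶ subObj k (L i))
    (h0 : ∑ i ∈ T, h i ≫ subIncl k (L i) = 0) : ∀ i ∈ T, h i = 0 := by
  intro i hi
  ext z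
  refine Subtype.ext ?_
  refine (iSupIndep_iff_finsetSum_eq_zero_imp_eq_zero L).1 hL T
    (fun i => (h i ≫ subIncl k (L i)).hom.hom z) (fun i _ => comp_subIncl_mem _ _ z) ?_ i hi
  have := congrArg (fun f : Z ⟶ X => f.hom.hom z) h0
  simpa using this

theorem exists_sumData_indec (k : Type w) [Field k] [Algebra k A] [FiniteDimensional k A]
    (X : FGModuleCat.{u} A) :
    ∃ (ι : Type) (_ : Fintype ι) (W : ι → FGModuleCat.{u} A),
      (∀ i, IsIndec (W i)) ∧ Nonempty (SumData ι X W) := by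
  have : IsArtinianRing A := isArtinian_of_tower k inferInstance
  have : IsNoetherianRing A := isNoetherian_of_tower k inferInstance
  generalize hn : Module.length A X = n
  induction n using WellFoundedLT.induction generalizing X with
  | ind n ih =>
  by_cases h0 : Nontrivial X
  swap
  · rw [not_nontrivial_iff_subsingleton] at h0
    refine ⟨Empty, inferInstance, fun i => i.elim, fun i => i.elim, ⟨⟨fun i => i.elim,
      fun i => i.elim, fun i => i.elim, fun i => i.elim, ?_⟩⟩⟩
    ext x
    exact Subsingleton.elim (α := X) _ _
  by_cases hX : IsIndec X
  · exact ⟨Unit, inferInstance, fun _ => X, fun _ => hX, ⟨SumData.ofIso (Iso.refl X)⟩⟩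
  have : ¬ ∀ p q : Submodule A X, IsCompl p q → p = ⊥ ∨ q = ⊥ := fun h => hX ⟨h0, h⟩
  push Not at this
  obtain ⟨p, q, hpq, hp, hq⟩ := this
  let L : Bool → Submodule A X := fun b => if b then p else q
  have hLi : iSupIndep L := by
    rw [iSupIndep_pair (i := true) (j := false) (by simp) (by simp)]
    simpa [L] using hpq.disjoint
  have hLs : ⨆ b, L b = ⊤ := by
    rw [iSup_bool_eq]
    simpa [L] using hpq.sup_eq_top
  have hlt : ∀ b, L b < ⊤ := by
    rintro (_ | _)
    · refine lt_top_iff_ne_top.2 fun h => hp ?_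
      have h' : q = ⊤ := by simpa [L] using h
      exact disjoint_top.1 (h' ▸ hpq.disjoint)
    · refine lt_top_iff_ne_top.2 fun h => hq ?_
      have h' : p = ⊤ := by simpa [L] using h
      exact disjoint_top.1 (h' ▸ hpq.disjoint).symm
  have hlen : ∀ b, Module.length A (subObj k (L b)) < n := fun b => by
    rw [← hn]
    exact Submodule.length_lt (hlt b).ne
  choose ι hι W hW hB using fun b => ih _ (hlen b) (subObj k (L b)) rfl
  obtain ⟨B, -⟩ := nonempty_sumData_of_iSupIndep k hLi hLs
  let e : subObj k (⊤ : Submodule A X) ≅ X :=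
    { hom := subIncl k ⊤
      inv := liftSub k ⊤ (𝟙 X) fun _ => trivial
      hom_inv_id := rfl
      inv_hom_id := rfl }
  exact ⟨Σ b, ι b, inferInstance, fun p => W p.1 p.2, fun p => hW _ _,
    ⟨(B.congr e).sigma fun b => (hB b).some⟩⟩

/-! ### Finiteness of morphism spaces -/

open ModuleCat in
instance finiteDimensional_hom (X Y : FGModuleCat.{u} A) : FiniteDimensional k (X ⟶ Y) := by
  have : Module.Finite k X.obj := Module.Finite.trans A X.obj
  have : Module.Finite k Y.obj := Module.Finite.trans A Y.obj
  let φ : (X ⟶ Y) →ₗ[k] (X.obj →ₗ[k] Y.obj) :=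
    { toFun := fun f => f.hom.hom.restrictScalars k
      map_add' := fun _ _ => rfl
      map_smul' := fun _ _ => rfl }
  refine Module.Finite.of_injective φ fun f g h => ?_
  ext x
  exact LinearMap.congr_fun h x

variable (k) in
-- Morphism spaces are finite dimensional, so the descending chain of the `radⁿ(X, Y)` stabilizes.
-- This makes the successive removal of leading terms a finite process.
theorem exists_radPow_eq_iInf (X Y : FGModuleCat.{u} A) :
    ∃ N, radPow k N X Y = ⨅ n, radPow k n X Y := by
  let s : ℕ →o (Submodule k (X ⟶ Y))ᵒᵈ := ⟨fun n => radPow k n X Y, radPow_antitone k X Y⟩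
  obtain ⟨N, hN⟩ := IsArtinian.monotone_stabilizes s
  refine ⟨N, le_antisymm (le_iInf fun n => ?_) (iInf_le _ N)⟩
  rcases le_total N n with h | h
  · exact (show radPow k N X Y = radPow k n X Y from hN n h).le
  · exact radPow_antitone k X Y h

end Modules

/-! ### Consequences of the covering property -/

section Grading

variable {k : Type w} [Field k] {A : Type u} [Ring A] [Algebra k A]
variable {C : Type u'} [Category.{v'} C] [Preadditive C] [Linear k C]
variable {F : C ⥤ FGModuleCat.{u} A} [F.Additive] [F.Linear k]
variable {indA Γ : Set (FGModuleCat.{u} A)}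

theorem grMap_mk {V W : Type*} [AddCommGroup V] [Module k V] [AddCommGroup W] [Module k W]
    (φ : V →ₗ[k] W) {N P : Submodule k V} {N' P' : Submodule k W}
    (hN : ∀ v ∈ N, φ v ∈ N') (hP : ∀ v ∈ P, φ v ∈ P') (v : N) :
    grMap k φ hN hP (Submodule.Quotient.mk v) = Submodule.Quotient.mk ⟨φ v, hN v v.2⟩ := rfl

theorem gr_mk_eq_zero {V : Type*} [AddCommGroup V] [Module k V] {N P : Submodule k V} (v : N) :
    (Submodule.Quotient.mk v : Gr k N P) = 0 ↔ (v : V) ∈ P :=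
  Submodule.Quotient.mk_eq_zero _

theorem gr_mk_eq {V : Type*} [AddCommGroup V] [Module k V] {N P : Submodule k V} (v v' : N) :
    (Submodule.Quotient.mk v : Gr k N P) = Submodule.Quotient.mk v' ↔ (v : V) - v' ∈ P :=
  Submodule.Quotient.eq _

namespace HasCoveringProperty

variable (hF : HasCoveringProperty k F Γ)
include hF

/-- The injective half of the second bijection of the covering property, in terms of
representatives. -/
theorem mem_of_sum_mapFrom_mem {x y : C} {n : ℕ} (s : Finset {z : C // F.obj z = F.obj y})
    (φ : ∀ z : {z : C // F.obj z = F.obj y}, z.1 ⟶ x) (hφ : ∀ z ∈ s, φ z ∈ nonIsoPow k n z.1 x)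
    (h : ∑ z ∈ s, mapFrom k F x z.2 (φ z) ∈ radPow k (n + 1) (F.obj y) (F.obj x)) :
    ∀ z ∈ s, φ z ∈ nonIsoPow k (n + 1) z.1 x := by
  classical
  let ξ : ⨁ z : {z : C // F.obj z = F.obj y}, Gr k (nonIsoPow k n z.1 x)
      (nonIsoPow k (n + 1) z.1 x) :=
    ∑ z : s, DirectSum.lof k _ (fun z : {z : C // F.obj z = F.obj y} =>
      Gr k (nonIsoPow k n z.1 x) (nonIsoPow k (n + 1) z.1 x)) z.1
      (Submodule.Quotient.mk ⟨φ z.1, hφ z.1 z.2⟩)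
  have hξ : ξ = 0 := by
    refine (injective_iff_map_eq_zero _).1 (hF.bijective_from x y n).1 ξ ?_
    simp only [ξ, map_sum, DirectSum.toModule_lof, grMap_mk]
    have : ∀ z : s, mapFrom k F x z.1.2 (φ z.1) ∈ radPow k n (F.obj y) (F.obj x) := fun z =>
      mapFrom_mem k F hF.map_mem_rad n x z.1.2 _ (hφ z.1 z.2)
    refine (map_sum (Submodule.mkQ _) (fun z : s =>
      (⟨mapFrom k F x z.1.2 (φ z.1), this z⟩ : radPow k n (F.obj y) (F.obj x)))
      Finset.univ).symm.trans ?_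
    rw [Submodule.mkQ_apply, gr_mk_eq_zero, AddSubmonoidClass.coe_finsetSum,
      Finset.sum_coe_sort s fun z => mapFrom k F x z.2 (φ z)]
    exact h
  intro z hz
  have h1 := congrArg (fun ζ => DirectSum.component k _ _ z ζ) hξ
  simp only [ξ, map_sum, map_zero] at h1
  rw [Finset.sum_eq_single ⟨z, hz⟩] at h1
  · rw [DirectSum.component.lof_self, gr_mk_eq_zero] at h1
    exact h1
  · intro z' _ hz'
    rw [DirectSum.component.of, dif_neg]
    exact fun h => hz' (Subtype.ext h)
  · simp

/-- The surjective half of the same bijection. -/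
theorem radPow_le {x y : C} (n : ℕ) : radPow k n (F.obj y) (F.obj x) ≤
    (⨆ z : {z : C // F.obj z = F.obj y}, (nonIsoPow k n z.1 x).map (mapFrom k F x z.2)) ⊔
      radPow k (n + 1) (F.obj y) (F.obj x) := by
  classical
  intro g hg
  set P := (⨆ z : {z : C // F.obj z = F.obj y}, (nonIsoPow k n z.1 x).map (mapFrom k F x z.2)) ⊔
      radPow k (n + 1) (F.obj y) (F.obj x) with hP
  obtain ⟨ξ, hξ⟩ := (hF.bijective_from x y n).2 (Submodule.Quotient.mk ⟨g, hg⟩)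
  have key : ∀ ξ, DirectSum.toModule k {z : C // F.obj z = F.obj y}
      (RadGr k n (F.obj y) (F.obj x))
      (fun z => grMap k (N := nonIsoPow k n z.1 x) (P := nonIsoPow k (n + 1) z.1 x)
        (mapFrom k F x z.2) (mapFrom_mem k F hF.map_mem_rad n x z.2)
        (mapFrom_mem k F hF.map_mem_rad (n + 1) x z.2)) ξ ∈
      (P.submoduleOf (radPow k n (F.obj y) (F.obj x))).map (Submodule.mkQ _) := by
    intro ξ
    induction ξ using DirectSum.induction_on with
    | zero => rw [map_zero]; exact Submodule.zero_mem _
    | add a b ha hb => rw [map_add]; exact Submodule.add_mem _ ha hb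
    | of z a =>
      obtain ⟨v, rfl⟩ := Submodule.Quotient.mk_surjective _ a
      erw [DirectSum.toModule_lof]
      rw [grMap_mk]
      refine ⟨_, ?_, rfl⟩
      exact (le_sup_left : _ ≤ P) (Submodule.mem_iSup_of_mem z ⟨v.1, v.2, rfl⟩)
  obtain ⟨p, hp, hpg⟩ := hξ ▸ key ξ
  have h1 : p.1 - g ∈ radPow k (n + 1) (F.obj y) (F.obj x) := (gr_mk_eq p ⟨g, hg⟩).1 hpg
  have h2 : p.1 - (p.1 - g) ∈ P := Submodule.sub_mem _ hp ((le_sup_right : _ ≤ P) h1)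
  rwa [sub_sub_cancel] at h2

/-- Injectivity on the single summand `z = x`, used once for each degree: `F` reflects the
filtration. -/
theorem mem_nonIsoPow_of_map_mem {x y : C} {φ : x ⟶ y} {n : ℕ}
    (h : F.map φ ∈ radPow k n (F.obj x) (F.obj y)) : φ ∈ nonIsoPow k n x y := by
  classical
  induction n with
  | zero => exact Submodule.mem_top
  | succ n ih =>
    have h1 := ih (radPow_antitone k _ _ (Nat.le_succ n) h)
    refine hF.mem_of_sum_mapFrom_mem (y := x) {⟨x, rfl⟩}
      (fun z => if hz : z.1 = x then eqToHom hz ≫ φ else 0) ?_ ?_ ⟨x, rfl⟩ (by simp)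
      |> fun h => by simpa using h
    · simpa using h1
    · simpa [mapFrom] using h

end HasCoveringProperty

/-! ### Gradings of the radical layers of morphisms from an indecomposable module -/

/-- Subspaces of morphisms `W ⟶ F x`, indexed by a set `σ` and by the degree, which represent
the layers `radᵐ/radᵐ⁺¹(W, F x)`, and which are compatible with the homogeneous
morphisms of `C`. -/
structure SourceGrading (hC : IsWithLength k C) (F : C ⥤ FGModuleCat.{u} A)
    (W : FGModuleCat.{u} A) where
  σ : Type u'
  H : σ → ℕ → ∀ x : C, Submodule k (W ⟶ F.obj x)
  le : ∀ i m x, H i m x ≤ radPow k m W (F.obj x)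
  eq_zero : ∀ (m : ℕ) (x : C) (s : Finset σ) (h : σ → (W ⟶ F.obj x)),
    (∀ i ∈ s, h i ∈ H i m x) → ∑ i ∈ s, h i ∈ radPow k (m + 1) W (F.obj x) → ∀ i ∈ s, h i = 0
  radPow_le : ∀ m x, radPow k m W (F.obj x) ≤ (⨆ i, H i m x) ⊔ radPow k (m + 1) W (F.obj x)
  comp_mem : ∀ (i : σ) (m d : ℕ) (x y : C) (h : W ⟶ F.obj x) (φ : x ⟶ y), h ∈ H i m x →
    φ ∈ degPart hC d x y → h ≫ F.map φ ∈ H i (m + d) y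
  lift : ∀ i, ∃ (z : C) (e : W ≅ F.obj z), ∀ (m : ℕ) (x : C) (h : W ⟶ F.obj x), h ∈ H i m x →
    ∃ φ ∈ degPart hC m z x, h = e.hom ≫ F.map φ

variable (hC : IsWithLength k C)

/-- The grading for a module in the image of a functor with the covering property. -/
def SourceGrading.ofObj (hF : HasCoveringProperty k F Γ) (y : C) :
    SourceGrading hC F (F.obj y) where
  σ := {z : C // F.obj z = F.obj y}
  H z m x := (degPart hC m z.1 x).map (mapFrom k F x z.2)
  le := by
    rintro z m x _ ⟨φ, hφ, rfl⟩
    exact mapFrom_mem k F hF.map_mem_rad m x z.2 φ hφ.1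
  eq_zero := by
    classical
    intro m x s h hh hs
    have : ∀ i : {z : C // F.obj z = F.obj y}, ∃ φ : i.1 ⟶ x,
        i ∈ s → φ ∈ degPart hC m i.1 x ∧ mapFrom k F x i.2 φ = h i := by
      intro i
      by_cases hi : i ∈ s
      · obtain ⟨φ, hφ, hφ'⟩ := hh i hi
        exact ⟨φ, fun _ => ⟨hφ, hφ'⟩⟩
      · exact ⟨0, fun h => (hi h).elim⟩
    choose φ hφ using this
    intro i hi
    have h1 := hF.mem_of_sum_mapFrom_mem s φ (fun z hz => (hφ z hz).1.1)
      (by rwa [Finset.sum_congr rfl fun z hz => (hφ z hz).2]) i hi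
    rw [← (hφ i hi).2, (hφ i hi).1.2 h1, map_zero]
  radPow_le := by
    intro m x
    refine (hF.radPow_le m).trans (sup_le (iSup_le fun z => ?_) le_sup_right)
    rintro _ ⟨φ, hφ, rfl⟩
    obtain ⟨ψ, hψ, hsub⟩ := exists_degPart_sub_mem hC hφ
    rw [← add_sub_cancel ψ φ, map_add]
    exact Submodule.add_mem_sup (Submodule.mem_iSup_of_mem z ⟨ψ, hψ, rfl⟩)
      (mapFrom_mem k F hF.map_mem_rad (m + 1) x z.2 _ hsub)
  comp_mem := by
    rintro z m d x x' _ φ ⟨ψ, hψ, rfl⟩ hφ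
    exact ⟨ψ ≫ φ, comp_mem_degPart hC hψ hφ, by simp [mapFrom]⟩
  lift := by
    intro z
    refine ⟨z.1, eqToIso z.2.symm, ?_⟩
    rintro m x _ ⟨φ, hφ, rfl⟩
    exact ⟨φ, hφ, by simp [mapFrom]⟩

/-- Transport of a grading along an isomorphism. -/
def SourceGrading.congr {hC : IsWithLength k C} {W W' : FGModuleCat.{u} A}
    (G : SourceGrading hC F W) (e : W ≅ W') : SourceGrading hC F W' where
  σ := G.σ
  H i m x := (G.H i m x).comap (Linear.leftComp k (F.obj x) e.hom)
  le := by
    intro i m x g hg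
    have := comp_radPow k e.inv (G.le i m x hg)
    simpa using this
  eq_zero := by
    intro m x s h hh hs i hi
    have := G.eq_zero m x s (fun i => e.hom ≫ h i) hh
      (by rw [← Preadditive.comp_sum]; exact comp_radPow k e.hom hs) i hi
    simpa using this
  radPow_le := by
    intro m x g hg
    obtain ⟨a, ha, b, hb, hab⟩ := Submodule.mem_sup.1
      (G.radPow_le m x (comp_radPow k e.hom hg))
    have : g = e.inv ≫ a + e.inv ≫ b := by
      rw [← Preadditive.comp_add, hab, Iso.inv_hom_id_assoc]
    rw [this]
    refine Submodule.add_mem_sup ?_ (comp_radPow k e.inv hb)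
    have hle : ⨆ i, G.H i m x ≤
        (⨆ i, (G.H i m x).comap (Linear.leftComp k (F.obj x) e.hom)).comap
          (Linear.leftComp k (F.obj x) e.inv) := by
      refine iSup_le fun i c hc => Submodule.mem_iSup_of_mem i ?_
      simpa using hc
    exact hle ha
  comp_mem := by
    intro i m d x y h φ hh hφ
    have := G.comp_mem i m d x y _ φ hh hφ
    simpa using this
  lift := by
    intro i
    obtain ⟨z, ε, hz⟩ := G.lift i
    refine ⟨z, e.symm ≪≫ ε, fun m x h hh => ?_⟩
    obtain ⟨φ, hφ, hh'⟩ := hz m x _ hh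
    refine ⟨φ, hφ, ?_⟩
    simp only [Linear.leftComp_apply] at hh'
    simp [← hh']

/-- The empty grading, for modules all whose morphisms to the `F x` lie in the infinite
radical. -/
def SourceGrading.empty {W : FGModuleCat.{u} A}
    (h : ∀ m x, radPow k m W (F.obj x) ≤ radPow k (m + 1) W (F.obj x)) :
    SourceGrading hC F W where
  σ := PEmpty
  H i := i.elim
  le i := i.elim
  eq_zero _ _ _ _ _ _ i := i.elim
  radPow_le m x := (h m x).trans le_sup_right
  comp_mem i := i.elim
  lift i := i.elim

variable [FiniteDimensional k A]

/-- A morphism in `radᵐ⁺¹ ∖ radᵐ⁺²` has a composite `a ≫ b` through an indecomposable module `U`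
with the same property. Then `b ∉ rad²` gives an arrow of the quiver from `U` to `X`, so `U` belongs
to `Γ` up to isomorphism, and `a ∈ radᵐ ∖ radᵐ⁺¹` allows induction. In degree zero the morphism is
invertible. -/
theorem exists_iso_mem_component (hind : IsIndRepresentatives indA) (hΓ : IsARComponent k indA Γ)
    {m : ℕ} {W X : FGModuleCat.{u} A} (hW : IsIndec W) (hX : X ∈ Γ) {f : W ⟶ X}
    (hf : f ∈ radPow k m W X) (hf' : f ∉ radPow k (m + 1) W X) :
    ∃ V ∈ Γ, Nonempty (W ≅ V) := by
  obtain ⟨X₀, hX₀, rfl⟩ := hΓ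
  induction m generalizing X with
  | zero =>
    rw [mem_radPow_one_iff] at hf'
    have := hW.isIso_of_not_mem_catRad (hind.indec X hX.1) hf'
    exact ⟨X, hX, ⟨asIso f⟩⟩
  | succ m ih =>
    have : ∃ (V : FGModuleCat.{u} A) (a : W ⟶ V) (b : V ⟶ X), a ∈ radPow k m W V ∧
        b ∈ catRad k V X ∧ a ≫ b ∉ radPow k (m + 1 + 1) W X := by
      by_contra! hcon
      refine hf' ((Submodule.span_le (p := radPow k (m + 1 + 1) W X)).2 ?_ hf)
      rintro _ ⟨V, a, b, ha, hb, rfl⟩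
      exact hcon V a b ha hb
    obtain ⟨V, a, b, ha, hb, hab⟩ := this
    obtain ⟨ι, hι, U, hU, ⟨B⟩⟩ := exists_sumData_indec k V
    have : ∃ i, (a ≫ B.proj i) ≫ B.inj i ≫ b ∉ radPow k (m + 1 + 1) W X := by
      by_contra! hcon
      apply hab
      have h1 : a ≫ b = ∑ i, (a ≫ B.proj i) ≫ B.inj i ≫ b := by
        have : a ≫ (∑ i, B.proj i ≫ B.inj i) ≫ b = a ≫ b := by simp [B.sum_proj_inj]
        rw [← this, Preadditive.sum_comp, Preadditive.comp_sum]
        simp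
      rw [h1]
      exact Submodule.sum_mem _ fun i _ => hcon i
    obtain ⟨i, hi⟩ := this
    have ha1 : a ≫ B.proj i ∈ radPow k m W (U i) := radPow_comp k ha _
    have hb1 : B.inj i ≫ b ∈ radPow k 1 (U i) X := comp_radPow k _ (mem_idealPow_one k hb)
    have ha2 : a ≫ B.proj i ∉ radPow k (m + 1) W (U i) := fun h =>
      hi (radPow_comp_radPow k h hb1)
    have hb2 : B.inj i ≫ b ∉ radPow k 2 (U i) X := fun h => hi (radPow_comp_radPow k (a := m) (b := 2) ha1 h)
    obtain ⟨U', ⟨hU', ⟨e⟩⟩, -⟩ := hind.existsUnique (U i) (hU i)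
    have harr : ARArrow k indA U' X := by
      refine ⟨hU', hX.1, ?_⟩
      have hc1 : e.inv ≫ B.inj i ≫ b ∈ radPow k 1 U' X := comp_radPow k _ hb1
      refine ⟨Submodule.Quotient.mk ⟨_, hc1⟩, 0, fun h => hb2 ?_⟩
      rw [gr_mk_eq_zero] at h
      have := comp_radPow k e.hom h
      simpa using this
    refine ih (X := U') (hX := ⟨hU', hX.2.trans _ _ _ ((Relation.EqvGen.rel _ _ harr).symm)⟩)
      (f := (a ≫ B.proj i) ≫ e.hom) (hf := radPow_comp k ha1 _) (hf' := fun h => ha2 ?_)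
    have := radPow_comp k h e.inv
    simpa using this

theorem nonempty_sourceGrading (hind : IsIndRepresentatives indA) (hΓ : IsARComponent k indA Γ)
    (hF : HasCoveringProperty k F Γ) {W : FGModuleCat.{u} A} (hW : IsIndec W) :
    Nonempty (SourceGrading hC F W) := by
  by_cases h : ∃ V ∈ Γ, Nonempty (W ≅ V)
  · obtain ⟨V, hV, ⟨e⟩⟩ := h
    obtain ⟨y, rfl⟩ := hF.exists_obj_eq V hV
    exact ⟨(SourceGrading.ofObj hC hF y).congr e.symm⟩
  · refine ⟨SourceGrading.empty hC fun m x f hf => ?_⟩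
    by_contra hf'
    exact h (exists_iso_mem_component hind hΓ hW (hF.obj_mem x) hf hf')

end Grading

section Decompositions

variable {k : Type w} [Field k] {A : Type u} [Ring A] [Algebra k A]
variable {C : Type u'} [Category.{v'} C] [Preadditive C] [Linear k C]
variable {F : C ⥤ FGModuleCat.{u} A}
variable {Γ : Set (FGModuleCat.{u} A)}

/-! ### Decompositions with summands in the image of the functor -/

omit [Preadditive C] in
theorem Decomp.ext_proj {X W : FGModuleCat.{u} A} (DX : Decomp F X) {a b : W ⟶ X}
    (h : ∀ s, a ≫ DX.proj s = b ≫ DX.proj s) : a = b := by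
  rw [← Category.comp_id a, ← Category.comp_id b, ← DX.sum_proj_inj, Preadditive.comp_sum,
    Preadditive.comp_sum]
  refine Finset.sum_congr rfl fun s _ => ?_
  rw [← Category.assoc, h, Category.assoc]

omit [Preadditive C] in
theorem Decomp.sum_comp_proj_inj {X W : FGModuleCat.{u} A} (DX : Decomp F X) (a : W ⟶ X) :
    a = ∑ s, (a ≫ DX.proj s) ≫ DX.inj s := by
  conv_lhs => rw [← Category.comp_id a, ← DX.sum_proj_inj, Preadditive.comp_sum]
  simp

/-- A decomposition with summands in the image of the functor, as a `SumData`. -/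
def Decomp.toSumData {X : FGModuleCat.{u} A} (DX : Decomp F X) :
    SumData (Fin DX.r) X fun s => F.obj (DX.obj s) :=
  ⟨DX.inj, DX.proj, DX.inj_proj, DX.inj_proj_ne, DX.sum_proj_inj⟩

/-- A `SumData` with summands in the image of the functor, as a decomposition. -/
def SumData.toDecomp {ι : Type} [Fintype ι] {X : FGModuleCat.{u} A} {x : ι → C}
    (B : SumData ι X fun i => F.obj (x i)) : Decomp F X :=
  let B' := B.reindex (Fintype.equivFin ι).symm
  ⟨Fintype.card ι, fun s => x ((Fintype.equivFin ι).symm s), B'.inj, B'.proj, B'.inj_proj,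
    B'.inj_proj_ne, B'.sum_proj_inj⟩

variable {hC : IsWithLength k C}

omit [Algebra k A] in
variable (hC) in
theorem isHomogeneousOfDegree_iff {d : ℕ} {X Y : FGModuleCat.{u} A} {DX : Decomp F X}
    {DY : Decomp F Y} {f : X ⟶ Y} : IsHomogeneousOfDegree k d DX DY f ↔
      ∀ s t, ∃ φ ∈ degPart hC d (DX.obj s) (DY.obj t),
        DX.inj s ≫ f ≫ DY.proj t = F.map φ := by
  constructor
  · rintro ⟨φ, h1, h2, h3⟩ s t
    exact ⟨φ s t, ⟨h1 s t, h2 s t⟩, h3 s t⟩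
  · intro h
    choose φ hφ hφ' using h
    exact ⟨φ, fun s t => (hφ s t).1, fun s t => (hφ s t).2, hφ'⟩

variable [F.Additive] [F.Linear k]

/-- The components of the homogeneous summand `g` of `f` lie in `radᵈ`. As `F` reflects the
filtration, they come from `ℛᵈ`, where their components of degree `d` can be taken. -/
theorem exists_homogeneousPart (hC : IsWithLength k C) (hF : HasCoveringProperty k F Γ)
    {d : ℕ} {X Y : FGModuleCat.{u} A} {f : X ⟶ Y} (hf : f ∈ radPow k d X Y)
    (hhom : IsHomogeneousUpTo k F (d + 1) f) :
    ∃ (DX : Decomp F X) (DY : Decomp F Y) (f' : X ⟶ Y), IsHomogeneousPart k d DX DY f f' := by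
  obtain ⟨g, ⟨DX, DY, φ, hφ⟩, hfg⟩ := hhom
  have hg : g ∈ radPow k d X Y := by
    rw [← sub_sub_cancel f g]
    exact Submodule.sub_mem _ hf (radPow_antitone k X Y (Nat.le_succ d) hfg)
  have hφd : ∀ s t, φ s t ∈ nonIsoPow k d _ _ := fun s t => by
    apply hF.mem_nonIsoPow_of_map_mem
    rw [← hφ]
    exact comp_radPow k _ (radPow_comp k hg _)
  choose ψ hψ hsub using fun s t => exists_degPart_sub_mem hC (hφd s t)
  let f' : X ⟶ Y := ∑ s, ∑ t, DX.proj s ≫ F.map (ψ s t) ≫ DY.inj t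
  have hgsum : g = ∑ s, ∑ t, DX.proj s ≫ F.map (φ s t) ≫ DY.inj t := by
    have h1 : g = (∑ s, DX.proj s ≫ DX.inj s) ≫ g ≫ ∑ t, DY.proj t ≫ DY.inj t := by
      rw [DX.sum_proj_inj, DY.sum_proj_inj]
      simp
    conv_lhs => rw [h1]
    rw [Preadditive.sum_comp]
    refine Finset.sum_congr rfl fun s _ => ?_
    rw [Preadditive.comp_sum, Preadditive.comp_sum]
    refine Finset.sum_congr rfl fun t _ => ?_
    rw [← hφ]
    simp
  refine ⟨DX, DY, f', ?_, (isHomogeneousOfDegree_iff hC).2 fun s t => ⟨ψ s t, hψ s t, ?_⟩⟩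
  · have hgf : g - f' ∈ radPow k (d + 1) X Y := by
      rw [hgsum]
      simp only [f', ← Finset.sum_sub_distrib]
      refine Submodule.sum_mem _ fun s _ => Submodule.sum_mem _ fun t _ => ?_
      rw [← Preadditive.comp_sub, ← Preadditive.sub_comp, ← F.map_sub]
      exact comp_radPow k _ (radPow_comp k (map_nonIsoPow k F hF.map_mem_rad _ _ (hsub s t)) _)
    rw [← sub_add_sub_cancel f g f']
    exact Submodule.add_mem _ hfg hgf
  · simp only [f', Preadditive.sum_comp, Preadditive.comp_sum, Category.assoc]
    rw [Finset.sum_eq_single s, Finset.sum_eq_single t]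
    · rw [DY.inj_proj, ← Category.assoc, DX.inj_proj]
      simp
    · intro t' _ ht'
      rw [DY.inj_proj_ne _ _ ht']
      simp
    · simp
    · intro s' _ hs'
      refine Finset.sum_eq_zero fun t' _ => ?_
      rw [← Category.assoc, DX.inj_proj_ne _ _ hs'.symm, Limits.zero_comp]
    · simp

/-! ### Homogeneous morphisms from an indecomposable module -/

namespace SourceGrading

omit [F.Additive] [F.Linear k]

variable {W X Y : FGModuleCat.{u} A} (G : SourceGrading hC F W) (DX : Decomp F X)
  (DY : Decomp F Y)

/-- The morphisms to `X` whose components lie in the graded pieces of index `i` and degree `m`. -/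
def piece (i : G.σ) (m : ℕ) : Submodule k (W ⟶ X) :=
  ⨅ s, (G.H i m (DX.obj s)).comap (Linear.rightComp k W (DX.proj s))

/-- The morphisms to `X` of degree `m`. -/
def part (m : ℕ) : Submodule k (W ⟶ X) := ⨆ i, G.piece DX i m

variable {G DX DY}

theorem mem_piece {i : G.σ} {m : ℕ} {g : W ⟶ X} :
    g ∈ G.piece DX i m ↔ ∀ s, g ≫ DX.proj s ∈ G.H i m (DX.obj s) := by
  simp [piece]

theorem piece_le (i : G.σ) (m : ℕ) : G.piece DX i m ≤ radPow k m W X := by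
  intro g hg
  rw [DX.sum_comp_proj_inj g]
  exact Submodule.sum_mem _ fun s _ => radPow_comp k (G.le i m _ (mem_piece.1 hg s)) _

theorem part_le (m : ℕ) : G.part DX m ≤ radPow k m W X := iSup_le fun i => piece_le i m

theorem eq_zero_of_mem_piece {m : ℕ} (s : Finset G.σ) (h : G.σ → (W ⟶ X))
    (hh : ∀ i ∈ s, h i ∈ G.piece DX i m) (hs : ∑ i ∈ s, h i ∈ radPow k (m + 1) W X) :
    ∀ i ∈ s, h i = 0 := by
  intro i hi
  refine DX.ext_proj fun t => ?_
  rw [Limits.zero_comp]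
  refine G.eq_zero m _ s (fun i => h i ≫ DX.proj t) (fun i hi => mem_piece.1 (hh i hi) t) ?_ i hi
  rw [← Preadditive.sum_comp]
  exact radPow_comp k hs _

theorem exists_sum_of_mem_part {m : ℕ} {a : W ⟶ X} (ha : a ∈ G.part DX m) :
    ∃ (s : Finset G.σ) (h : G.σ → (W ⟶ X)), (∀ i, h i ∈ G.piece DX i m) ∧
      ∑ i ∈ s, h i = a := by
  obtain ⟨f, hf, rfl⟩ := (Submodule.mem_iSup_iff_exists_finsupp _ _).1 ha
  exact ⟨f.support, f, hf, rfl⟩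

/-- The parts are true complements, not only representatives: a morphism of degree `m` cannot lie
deeper in the filtration unless it is zero. -/
theorem eq_zero_of_mem_part {m : ℕ} {a : W ⟶ X} (ha : a ∈ G.part DX m)
    (ha' : a ∈ radPow k (m + 1) W X) : a = 0 := by
  obtain ⟨s, h, hh, rfl⟩ := exists_sum_of_mem_part ha
  exact Finset.sum_eq_zero (eq_zero_of_mem_piece s h (fun i _ => hh i) ha')

theorem radPow_le_part (m : ℕ) :
    radPow k m W X ≤ G.part DX m ⊔ radPow k (m + 1) W X := by
  intro g hg
  rw [DX.sum_comp_proj_inj g]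
  refine Submodule.sum_mem _ fun s _ => ?_
  obtain ⟨a, ha, b, hb, hab⟩ := Submodule.mem_sup.1
    (G.radPow_le m (DX.obj s) (radPow_comp k hg (DX.proj s)))
  rw [← hab, Preadditive.add_comp]
  refine Submodule.add_mem_sup ?_ (radPow_comp k hb _)
  have hle : ⨆ i, G.H i m (DX.obj s) ≤ (G.part DX m).comap (Linear.rightComp k W (DX.inj s)) := by
    refine iSup_le fun i c hc => Submodule.mem_iSup_of_mem i (mem_piece.2 fun t => ?_)
    rw [Linear.rightComp_apply, Category.assoc]
    by_cases hst : s = t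
    · subst hst
      simpa [DX.inj_proj] using hc
    · rw [DX.inj_proj_ne s t hst, Limits.comp_zero]
      exact Submodule.zero_mem _
  exact hle ha

variable {d : ℕ} {f : X ⟶ Y}

/-- The index `i` records a lift of the source to `C`, which postcomposition leaves unchanged. -/
theorem comp_mem_piece (hf : IsHomogeneousOfDegree k d DX DY f) {i : G.σ} {m : ℕ} {g : W ⟶ X}
    (hg : g ∈ G.piece DX i m) : g ≫ f ∈ G.piece DY i (m + d) := by
  rw [mem_piece] at hg ⊢
  intro t
  rw [DX.sum_comp_proj_inj g, Preadditive.sum_comp, Preadditive.sum_comp]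
  refine Submodule.sum_mem _ fun s _ => ?_
  obtain ⟨φ, hφ, hφ'⟩ := (isHomogeneousOfDegree_iff hC).1 hf s t
  have := G.comp_mem i m d _ _ _ φ (hg s) hφ
  rw [← hφ'] at this
  simpa using this

theorem comp_mem_part (hf : IsHomogeneousOfDegree k d DX DY f) {m : ℕ} {g : W ⟶ X}
    (hg : g ∈ G.part DX m) : g ≫ f ∈ G.part DY (m + d) := by
  have : G.part DX m ≤ (G.part DY (m + d)).comap (Linear.rightComp k W f) :=
    iSup_le fun i a ha => Submodule.mem_iSup_of_mem i (comp_mem_piece hf ha)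
  exact this hg

/-- Here `a` is the component of `g` of degree `m`. Then `a ≫ f` is homogeneous of degree `m + d`
and lies in `radᵐ⁺ᵈ⁺¹`, so it vanishes. -/
theorem exists_part_comp_eq_zero (hf : IsHomogeneousOfDegree k d DX DY f) {m : ℕ} {g : W ⟶ X}
    (hg : g ∈ radPow k m W X) (hgf : g ≫ f ∈ radPow k (m + d + 1) W Y)
    (hfd : f ∈ radPow k d X Y) :
    ∃ a ∈ G.part DX m, a ≫ f = 0 ∧ g - a ∈ radPow k (m + 1) W X := by
  obtain ⟨a, ha, b, hb, rfl⟩ := Submodule.mem_sup.1 (radPow_le_part (G := G) (DX := DX) m hg)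
  refine ⟨a, ha, eq_zero_of_mem_part (comp_mem_part hf ha) ?_, by simpa using hb⟩
  rw [Preadditive.add_comp] at hgf
  have hbf := radPow_comp_radPow k hb hfd
  rw [Nat.add_right_comm] at hbf
  exact (Submodule.add_mem_iff_left _ hbf).1 hgf

variable [FiniteDimensional k A]

/-- Leading terms are removed one after the other. Each is killed by `f`, and so is each of its
summands of fixed index, since `f` preserves the index and different indices are independent. -/
theorem mem_span_of_comp_eq_zero (hf : IsHomogeneousOfDegree k d DX DY f)
    (hfd : f ∈ radPow k d X Y) {g : W ⟶ X} (hg : g ≫ f = 0) :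
    g ∈ Submodule.span k {v : W ⟶ X | v ≫ f = 0 ∧
      (v ∈ ⨅ N, radPow k N W X ∨ ∃ i m, v ∈ G.piece DX i m)} := by
  set S := {v : W ⟶ X | v ≫ f = 0 ∧ (v ∈ ⨅ N, radPow k N W X ∨ ∃ i m, v ∈ G.piece DX i m)}
    with hS
  have hker : ∀ a ∈ Submodule.span k S, a ≫ f = 0 := by
    have : Submodule.span k S ≤ LinearMap.ker (Linear.rightComp k W f) :=
      Submodule.span_le.2 fun v hv => hv.1
    exact fun a ha => this ha
  have key : ∀ N, ∃ a ∈ Submodule.span k S, g - a ∈ radPow k N W X := by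
    intro N
    induction N with
    | zero => exact ⟨0, Submodule.zero_mem _, Submodule.mem_top⟩
    | succ N ih =>
      obtain ⟨a, ha, hga⟩ := ih
      have h0 : (g - a) ≫ f = 0 := by rw [Preadditive.sub_comp, hg, hker a ha, sub_zero]
      obtain ⟨b, hb, hbf, hgb⟩ := exists_part_comp_eq_zero (G := G) hf hga
        (by rw [h0]; exact Submodule.zero_mem _) hfd
      refine ⟨a + b, Submodule.add_mem _ ha ?_, by rwa [← sub_sub]⟩
      obtain ⟨s, h, hh, rfl⟩ := exists_sum_of_mem_part hb
      have h1 := eq_zero_of_mem_piece s (fun i => h i ≫ f) (fun i _ => comp_mem_piece hf (hh i))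
        (by rw [← Preadditive.sum_comp, hbf]; exact Submodule.zero_mem _)
      exact Submodule.sum_mem _ fun i hi =>
        Submodule.subset_span ⟨h1 i hi, Or.inr ⟨i, N, hh i⟩⟩
  -- For this `N` the remainder in `radᴺ` already lies in the infinite radical.
  obtain ⟨N, hN⟩ := exists_radPow_eq_iInf k W X
  obtain ⟨a, ha, hga⟩ := key N
  rw [← sub_add_cancel g a]
  refine Submodule.add_mem _ (Submodule.subset_span ⟨?_, Or.inl (hN ▸ hga)⟩) ha
  rw [Preadditive.sub_comp, hg, hker a ha, sub_zero]

end SourceGrading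

end Decompositions

/-! ### Exchange of the injections of a decomposition into indecomposables -/

section Exchange

variable {k : Type w} [Field k] {A : Type u} [Ring A] [Algebra k A] [FiniteDimensional k A]

/-- Exchange one injection at a time. As `B₁.inj j` lies in the span of `S j` and the radical is a
subspace, not every `v ≫ B₁.proj j` with `v ∈ S j` can be radical: the identity of `W j` is not. A
non-radical one is invertible. -/
theorem SumData.exists_inj_mem {ι : Type*} [Fintype ι] {X : FGModuleCat.{u} A}
    {W : ι → FGModuleCat.{u} A} (hW : ∀ i, IsIndec (W i)) (B : SumData ι X W)
    (S : ∀ i, Set (W i ⟶ X)) (hS : ∀ i (g : W i ⟶ X), g ∈ Submodule.span k (S i)) :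
    ∃ B' : SumData ι X W, ∀ i, B'.inj i ∈ S i := by
  classical
  suffices h : ∀ s : Finset ι, ∃ B' : SumData ι X W, ∀ i ∈ s, B'.inj i ∈ S i by
    obtain ⟨B', hB'⟩ := h Finset.univ
    exact ⟨B', fun i => hB' i (Finset.mem_univ i)⟩
  intro s
  induction s using Finset.induction_on with
  | empty => exact ⟨B, by simp⟩
  | insert j s hj ih =>
    obtain ⟨B₁, hB₁⟩ := ih
    have : ∃ v ∈ S j, v ≫ B₁.proj j ∉ catRad k (W j) (W j) := by
      by_contra! hcon
      have hle : Submodule.span k (S j) ≤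
          (catRad k (W j) (W j)).comap (Linear.rightComp k (W j) (B₁.proj j)) :=
        Submodule.span_le.2 hcon
      have h1 := hle (hS j (B₁.inj j))
      rw [Submodule.mem_comap, Linear.rightComp_apply, B₁.inj_proj] at h1
      have := (hW j).1
      exact id_not_mem_catRad k (W j) h1
    obtain ⟨v, hv, hvp⟩ := this
    have := (hW j).isIso_of_not_mem_catRad (hW j) hvp
    obtain ⟨B₂, hB₂, hB₂'⟩ := B₁.exists_replace j v
    refine ⟨B₂, fun i hi => ?_⟩
    rcases Finset.mem_insert.1 hi with rfl | hi
    · rwa [hB₂]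
    · have hij : i ≠ j := fun h => hj (h ▸ hi)
      rw [hB₂' i hij]
      exact hB₁ i hi

variable (k) in
theorem SumData.exists_submodules {ι : Type*} [Fintype ι] {X : FGModuleCat.{u} A}
    {S : Submodule A X} {W : ι → FGModuleCat.{u} A} (B : SumData ι (subObj k S) W) :
    ∃ L : ι → Submodule A X, iSupIndep L ∧ ⨆ i, L i = S ∧
      ∀ i, ∃ e : W i ≅ subObj k (L i), e.hom ≫ subIncl k (L i) = B.inj i ≫ subIncl k S := by
  classical
  let u : ∀ i, W i ⟶ X := fun i => B.inj i ≫ subIncl k S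
  refine ⟨fun i => LinearMap.range (u i).hom.hom, ?_, le_antisymm ?_ ?_, ?_⟩
  · rw [iSupIndep_iff_finsetSum_eq_zero_imp_eq_zero]
    intro s v hv h0 j hj
    have : ∀ i, ∃ x : W i, i ∈ s → (u i).hom.hom x = v i := fun i => by
      by_cases hi : i ∈ s
      · obtain ⟨x, hx⟩ := hv i hi
        exact ⟨x, fun _ => hx⟩
      · exact ⟨0, fun h => (hi h).elim⟩
    choose x hx using this
    have h1 : ∑ i ∈ s, (B.inj i).hom.hom (x i) = 0 := by
      refine Subtype.ext ?_
      refine Eq.trans ?_ h0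
      refine (map_sum S.subtype _ s).trans ?_
      exact Finset.sum_congr rfl fun i hi => hx i hi
    have h2 := congrArg (B.proj j).hom.hom h1
    rw [map_sum, map_zero, Finset.sum_eq_single j] at h2
    · have h3 : (B.proj j).hom.hom ((B.inj j).hom.hom (x j)) = x j :=
        congrArg (fun f : W j ⟶ W j => f.hom.hom (x j)) (B.inj_proj j)
      rw [← hx j hj, ← h3, h2, map_zero]
    · intro i _ hij
      exact congrArg (fun f : W i ⟶ W j => f.hom.hom (x i)) (B.inj_proj_ne i j hij)
    · exact fun h => (h hj).elim
  · refine iSup_le fun i => ?_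
    rintro _ ⟨x, rfl⟩
    exact comp_subIncl_mem S (B.inj i) x
  · intro x hx
    have h1 : subIncl k S = ∑ i, B.proj i ≫ u i := by
      have := congrArg (· ≫ subIncl k S) B.sum_proj_inj
      simpa [Preadditive.sum_comp, u] using this.symm
    have h2 : ∀ y : subObj k S,
        (subIncl k S).hom.hom y = ∑ i, (u i).hom.hom ((B.proj i).hom.hom y) := fun y => by
      rw [h1, hom_hom_sum, LinearMap.sum_apply]
      rfl
    refine (show x = _ from h2 ⟨x, hx⟩) ▸ ?_
    exact Submodule.sum_mem _ fun i _ => Submodule.mem_iSup_of_mem i ⟨_, rfl⟩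
  · intro i
    have hiso : IsIso (liftSub k (LinearMap.range (u i).hom.hom) (u i) fun z => ⟨z, rfl⟩) := by
      rw [isIso_iff_bijective_hom]
      refine ⟨fun a b hab => ?_, ?_⟩
      · have h1 : (B.inj i).hom.hom a = (B.inj i).hom.hom b :=
          Subtype.ext (congrArg (fun t : LinearMap.range (u i).hom.hom => (t : X)) hab)
        have h2 := congrArg (B.proj i).hom.hom h1
        have h3 : ∀ c, (B.proj i).hom.hom ((B.inj i).hom.hom c) = c := fun c =>
          congrArg (fun f : W i ⟶ W i => f.hom.hom c) (B.inj_proj i)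
        rwa [h3, h3] at h2
      · rintro ⟨_, x, rfl⟩
        exact ⟨x, rfl⟩
    exact ⟨asIso (liftSub k _ (u i) fun z => ⟨z, rfl⟩), rfl⟩

theorem subIncl_mem_radPow_of_iSup {ι : Type*} {X : FGModuleCat.{u} A} {L : ι → Submodule A X}
    (hL : iSupIndep L) {S : Submodule A X} (hS : ⨆ i, L i = S) {m : ℕ}
    (h : ∀ i, subIncl k (L i) ∈ radPow k m (subObj k (L i)) X) :
    subIncl k S ∈ radPow k m (subObj k S) X := by
  obtain ⟨T, p, hp⟩ := exists_sum_comp_subIncl k hL (subIncl k S) fun z => hS ▸ z.2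
  rw [hp]
  exact Submodule.sum_mem _ fun i _ => comp_radPow k _ (h i)

end Exchange

/-! ### Kernels of homogeneous morphisms and their decompositions. -/

section Kernel

variable {k : Type w} [Field k] {A : Type u} [Ring A] [Algebra k A] [FiniteDimensional k A]
variable {C : Type u'} [Category.{v'} C] [Preadditive C] [Linear k C]
variable {F : C ⥤ FGModuleCat.{u} A}
variable {hC : IsWithLength k C}

omit [Algebra k A] [FiniteDimensional k A] in
theorem mem_ker_of_comp_eq_zero {W X Y : FGModuleCat.{u} A} {g : W ⟶ X} {f : X ⟶ Y}
    (h : g ≫ f = 0) (z : W) : g.hom.hom z ∈ LinearMap.ker f.hom.hom :=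
  congrArg (fun t : W ⟶ Y => t.hom.hom z) h

theorem subIncl_comp_eq_zero {X Y : FGModuleCat.{u} A} {f : X ⟶ Y} {S : Submodule A X}
    (h : S ≤ LinearMap.ker f.hom.hom) : subIncl k S ≫ f = 0 := by
  ext z
  exact h z.2

theorem subIncl_eq_zero {X : FGModuleCat.{u} A} {S : Submodule A X} (h : S = ⊥) :
    subIncl k S = 0 := by
  subst h
  ext z
  exact (Submodule.mem_bot A).1 z.2

/-! ### Existence of the decomposition of the kernel -/

/-- The submodule `L` of `X` is a possible indecomposable direct summand of `K⁽ᵗ⁾`. -/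
structure IsKernelSummand {X : FGModuleCat.{u} A} (DX : Decomp F X) (L : Submodule A X)
    (t : ℕ∞) : Prop where
  indec : IsIndec (subObj k L)
  top_mem : t = ⊤ → subIncl k L ∈ ⨅ N, radPow k N (subObj k L) X
  mem : ∀ m : ℕ, t = m → subIncl k L ∈ radPow k m (subObj k L) X
  not_mem : ∀ m : ℕ, t = m → subIncl k L ∉ radPow k (m + 1) (subObj k L) X
  homogeneous : ∀ m : ℕ, t = m → ∃ DK : Decomp F (subObj k L),
    IsHomogeneousOfDegree k m DK DX (subIncl k L)

theorem IsKernelSummand.of_mem_iInf {X W : FGModuleCat.{u} A} {DX : Decomp F X}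
    {L : Submodule A X} (hW : IsIndec W) (e : W ≅ subObj k L)
    (h : e.hom ≫ subIncl k L ∈ ⨅ N, radPow k N W X) : IsKernelSummand (k := k) DX L ⊤ where
  indec := hW.of_iso e
  top_mem _ := by
    rw [Submodule.mem_iInf] at h ⊢
    intro N
    have := comp_radPow k e.inv (h N)
    rwa [Iso.inv_hom_id_assoc] at this
  mem m hm := (ENat.natCast_ne_top m hm.symm).elim
  not_mem m hm := (ENat.natCast_ne_top m hm.symm).elim
  homogeneous m hm := (ENat.natCast_ne_top m hm.symm).elim

theorem IsKernelSummand.of_mem_piece {X W : FGModuleCat.{u} A} {DX : Decomp F X}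
    {L : Submodule A X} (hW : IsIndec W) (e : W ≅ subObj k L) (G : SourceGrading hC F W)
    {i : G.σ} {m : ℕ} (h : e.hom ≫ subIncl k L ∈ G.piece DX i m) :
    IsKernelSummand (k := k) DX L m where
  indec := hW.of_iso e
  top_mem hm := (ENat.natCast_ne_top m hm).elim
  mem m' hm := by
    obtain rfl : m = m' := by exact_mod_cast hm
    have := comp_radPow k e.inv (SourceGrading.piece_le _ _ h)
    rwa [Iso.inv_hom_id_assoc] at this
  not_mem m' hm hmem := by
    obtain rfl : m = m' := by exact_mod_cast hm
    have h0 : e.hom ≫ subIncl k L = 0 := SourceGrading.eq_zero_of_mem_part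
      (Submodule.mem_iSup_of_mem i h) (comp_radPow k e.hom hmem)
    have h1 : e.hom = 0 := by
      rw [← cancel_mono (subIncl k L), h0, Limits.zero_comp]
    have := hW.1
    apply id_ne_zero_of_nontrivial W
    rw [← e.hom_inv_id, h1, Limits.zero_comp]
  homogeneous m' hm := by
    obtain rfl : m = m' := by exact_mod_cast hm
    -- The index `i` provides `z` with `W ≅ F z`, so the decomposition of `L` has a single summand.
    obtain ⟨z, ε, hz⟩ := G.lift i
    let DK : Decomp F (subObj k L) :=
      SumData.toDecomp (x := fun _ : Unit => z) (SumData.ofIso (ε.symm ≪≫ e))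
    refine ⟨DK, (isHomogeneousOfDegree_iff hC).2 fun s t => ?_⟩
    obtain ⟨φ, hφ, hφ'⟩ := hz m (DX.obj t) _ (SourceGrading.mem_piece.1 h t)
    refine ⟨φ, hφ, ?_⟩
    change (ε.inv ≫ e.hom) ≫ subIncl k L ≫ DX.proj t = F.map φ
    rw [Category.assoc] at hφ' ⊢
    rw [hφ', Iso.inv_hom_id_assoc]

/-- By exchange, the injections of the indecomposable summands of the kernel can be chosen in the
spanning set of `mem_span_of_comp_eq_zero`: in the infinite radical, or homogeneous with a single
index. -/
theorem exists_kernel_summands {X Y : FGModuleCat.{u} A} {DX : Decomp F X} {DY : Decomp F Y}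
    (hG : ∀ W : FGModuleCat.{u} A, IsIndec W → Nonempty (SourceGrading hC F W))
    {d : ℕ} {f : X ⟶ Y} (hf : IsHomogeneousOfDegree k d DX DY f) (hfd : f ∈ radPow k d X Y) :
    ∃ (ι : Type) (_ : Fintype ι) (L : ι → Submodule A X) (t : ι → ℕ∞),
      iSupIndep L ∧ ⨆ j, L j = LinearMap.ker f.hom.hom ∧
      ∀ j, IsKernelSummand (k := k) DX (L j) (t j) := by
  set K := LinearMap.ker f.hom.hom with hK
  obtain ⟨ι, hι, W, hW, ⟨B⟩⟩ := exists_sumData_indec k (subObj k K)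
  let G : ∀ j, SourceGrading hC F (W j) := fun j => (hG (W j) (hW j)).some
  let S : ∀ j, Set (W j ⟶ subObj k K) := fun j =>
    {v | v ≫ subIncl k K ∈ ⨅ N, radPow k N (W j) X ∨
      ∃ i m, v ≫ subIncl k K ∈ (G j).piece DX i m}
  obtain ⟨B', hB'⟩ := B.exists_inj_mem hW S fun j g => by
    have h0 : (g ≫ subIncl k K) ≫ f = 0 := by
      rw [Category.assoc, subIncl_comp_eq_zero le_rfl, Limits.comp_zero]
    have h1 := SourceGrading.mem_span_of_comp_eq_zero (G := G j) hf hfd h0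
    have h2 : Submodule.span k {v : W j ⟶ X | v ≫ f = 0 ∧
        (v ∈ ⨅ N, radPow k N (W j) X ∨ ∃ i m, v ∈ (G j).piece DX i m)} ≤
        (Submodule.span k (S j)).map (Linear.rightComp k (W j) (subIncl k K)) := by
      refine Submodule.span_le.2 ?_
      rintro v ⟨hv, hv'⟩
      exact ⟨liftSub k K v (mem_ker_of_comp_eq_zero hv), Submodule.subset_span hv', rfl⟩
    obtain ⟨g', hg', hgg'⟩ := h2 h1
    have : g' = g := (cancel_mono (subIncl k K)).1 hgg'
    exact this ▸ hg'
  obtain ⟨L, hL, hLs, hLe⟩ := B'.exists_submodules k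
  have : ∀ j, ∃ t, IsKernelSummand (k := k) DX (L j) t := fun j => by
    obtain ⟨e, he⟩ := hLe j
    rcases hB' j with h | ⟨i, m, h⟩
    · rw [← he] at h
      exact ⟨_, IsKernelSummand.of_mem_iInf (hW j) e h⟩
    · rw [← he] at h
      exact ⟨_, IsKernelSummand.of_mem_piece (hW j) e (G j) h⟩
  choose t ht using this
  exact ⟨ι, hι, L, t, hL, hLs, ht⟩

theorem iSupIndep_iSup_fiber {α : Type*} [CompleteLattice α] [IsCompactlyGenerated α]
    [IsModularLattice α] {ι κ : Type*} {L : ι → α} (hL : iSupIndep L) (t : ι → κ) :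
    iSupIndep fun m => ⨆ j : {j // t j = m}, L j := by
  intro m
  have h := hL.disjoint_biSup_biSup (s := {j | t j = m}) (t := {j | t j ≠ m})
    (Set.disjoint_left.2 fun j hj hj' => hj' hj)
  refine h.mono ?_ ?_
  · exact iSup_le fun j => le_biSup L j.2
  · refine iSup₂_le fun m' hm' => iSup_le fun j => le_biSup L (i := (j : ι)) ?_
    exact fun h => hm' (j.2.symm.trans h)

/-- Summands of equal degree are grouped together. Each summand of finite degree `m` has its
inclusion killed by `f` and in `radᵐ ∖ radᵐ⁺¹`, so `hn` excludes the degrees below `n`. -/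
theorem nonempty_kernelDecomp {X Y : FGModuleCat.{u} A} {DX : Decomp F X} {DY : Decomp F Y}
    (hG : ∀ W : FGModuleCat.{u} A, IsIndec W → Nonempty (SourceGrading hC F W))
    {d n : ℕ} {f : X ⟶ Y} (hf : IsHomogeneousOfDegree k d DX DY f) (hfd : f ∈ radPow k d X Y)
    (hn : ∀ (m : ℕ) (Z : FGModuleCat.{u} A) (g : Z ⟶ X), IsIndec Z → g ∈ radPow k m Z X →
      g ∉ radPow k (m + 1) Z X → g ≫ f = 0 → n ≤ m) :
    Nonempty (KernelDecomp k DX f n) := by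
  obtain ⟨ι, hι, L, t, hL, hLs, ht⟩ := exists_kernel_summands hG hf hfd
  classical
  let e : ∀ m : ℕ, Fin (Fintype.card {j // t j = m}) ≃ {j // t j = m} := fun m =>
    (Fintype.equivFin _).symm
  refine ⟨{
    K := fun m => ⨆ j : {j // t j = m}, L j
    indep := iSupIndep_iSup_fiber hL t
    iSup_eq := ?_
    eq_bot := fun m hm => ?_
    r := fun m => Fintype.card {j // t j = m}
    Kr := fun m s => L (e m s)
    indep_Kr := fun m => hL.comp (Subtype.val_injective.comp (e m).injective)
    iSup_Kr := fun m => (e m).iSup_comp (g := fun j : {j // t j = m} => L j)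
    indec := fun m s => (ht _).indec
    incl_top_mem := ?_
    incl_mem := fun m => subIncl_mem_radPow_of_iSup (hL.comp Subtype.val_injective) rfl
      fun j => (ht j).mem m j.2
    incl_Kr_mem := fun m s => (ht _).mem m (e m s).2
    incl_Kr_not_mem := fun m s => (ht _).not_mem m (e m s).2
    homogeneous := fun m s => (ht _).homogeneous m (e m s).2 }⟩
  · rw [← hLs]
    exact le_antisymm (iSup_le fun m => iSup_le fun j => le_iSup L j)
      (iSup_le fun j => le_iSup_of_le (t j) (le_iSup_of_le ⟨j, rfl⟩ le_rfl))
  · refine iSup_eq_bot.2 fun j => (hm.not_ge ?_).elim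
    refine hn m _ (subIncl k (L j)) (ht j).indec ((ht j).mem m j.2) ((ht j).not_mem m j.2)
      (subIncl_comp_eq_zero ?_)
    rw [← hLs]
    exact le_iSup L j
  · rw [Submodule.mem_iInf]
    intro N
    exact subIncl_mem_radPow_of_iSup (hL.comp Subtype.val_injective) rfl
      fun j => (Submodule.mem_iInf _).1 ((ht j).top_mem j.2) N

/-! ### Consequences of a decomposition of the kernel -/

namespace KernelDecomp

variable {X Y : FGModuleCat.{u} A} {DX : Decomp F X} {f : X ⟶ Y} {n : ℕ}
  (E : KernelDecomp k DX f n)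

theorem K_le (t : ℕ∞) : E.K t ≤ LinearMap.ker f.hom.hom := by
  rw [← E.iSup_eq]
  exact le_iSup E.K t

theorem incl_mem_of_le {t : ℕ∞} {m : ℕ} (h : (m : ℕ∞) ≤ t) :
    subIncl k (E.K t) ∈ radPow k m (subObj k (E.K t)) X := by
  cases t with
  | top => exact (Submodule.mem_iInf _).1 E.incl_top_mem m
  | coe t => exact radPow_antitone k _ _ (by exact_mod_cast h) (E.incl_mem t)

theorem subIncl_ker_mem (E : KernelDecomp k DX f n) : subIncl k (LinearMap.ker f.hom.hom) ∈
    radPow k n (subObj k (LinearMap.ker f.hom.hom)) X := by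
  refine subIncl_mem_radPow_of_iSup E.indep E.iSup_eq fun t => ?_
  by_cases h : (n : ℕ∞) ≤ t
  · exact E.incl_mem_of_le h
  · lift t to ℕ using (lt_of_not_ge h).ne_top
    rw [subIncl_eq_zero (E.eq_bot t (by exact_mod_cast lt_of_not_ge h))]
    exact Submodule.zero_mem _

theorem exists_decomp_K (hC : IsWithLength k C) (m : ℕ) : ∃ DK : Decomp F (subObj k (E.K m)),
    IsHomogeneousOfDegree k m DK DX (subIncl k (E.K m)) := by
  obtain ⟨B, hB⟩ := nonempty_sumData_of_iSupIndep k (E.indep_Kr m) (E.iSup_Kr m)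
  choose DK hDK using E.homogeneous m
  let B' := B.sigma fun s => (DK s).toSumData
  refine ⟨SumData.toDecomp (x := fun p : Σ s, Fin (DK s).r => (DK p.1).obj p.2) B',
    (isHomogeneousOfDegree_iff hC).2 fun s t => ?_⟩
  set p := (Fintype.equivFin (Σ s, Fin (DK s).r)).symm s with hp
  obtain ⟨φ, hφ, hφ'⟩ := (isHomogeneousOfDegree_iff hC).1 (hDK p.1) p.2 t
  refine ⟨φ, hφ, hφ' ▸ ?_⟩
  change ((DK p.1).inj p.2 ≫ B.inj p.1) ≫ subIncl k (E.K m) ≫ DX.proj t = _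
  rw [Category.assoc, ← Category.assoc (B.inj p.1), hB]

/-- Induction on `q ≤ l`. The terms of degree `q - m` of the `h j` give terms of degree `q` in `X`,
whose sum lies in `rad^(q+1)` and is therefore zero. The sum of the `E.K (t j)` being direct, each
of these terms vanishes, so every `h j` is one step deeper. -/
theorem mem_radPow_of_sum_mem {Z : FGModuleCat.{u} A} (G : SourceGrading hC F Z) {τ : Type*}
    (T : Finset τ) {t : τ → ℕ∞} (ht : Function.Injective t) (h : ∀ j, Z ⟶ subObj k (E.K (t j)))
    {l : ℕ} (hl : ∑ j ∈ T, h j ≫ subIncl k (E.K (t j)) ∈ radPow k l Z X) :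
    ∀ j ∈ T, ∀ m : ℕ, t j = m → h j ∈ radPow k (l - m) Z (subObj k (E.K (t j))) := by
  suffices key : ∀ q ≤ l, ∀ j ∈ T, ∀ m : ℕ, t j = m →
      h j ∈ radPow k (q - m) Z (subObj k (E.K (t j))) from key l le_rfl
  intro q
  induction q with
  | zero =>
    intro _ j _ m _
    rw [Nat.zero_sub]
    exact Submodule.mem_top
  | succ q ih =>
    intro hq
    have ih := ih (Nat.le_of_succ_le hq)
    have hex : ∀ j, ∃ a : Z ⟶ subObj k (E.K (t j)), j ∈ T →
        a ≫ subIncl k (E.K (t j)) ∈ G.part DX q ∧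
        (h j - a) ≫ subIncl k (E.K (t j)) ∈ radPow k (q + 1) Z X ∧
        ∀ m : ℕ, t j = m → h j - a ∈ radPow k (q + 1 - m) Z (subObj k (E.K (t j))) := by
      intro j
      by_cases hj : j ∈ T
      swap
      · exact ⟨0, fun h => (hj h).elim⟩
      -- Summands of degree larger than `q` (or `⊤`) contribute no leading term: their inclusion is
      -- already in `rad^(q+1)`, and the truncated exponent `q + 1 - m` is zero.
      by_cases htq : t j ≤ q
      · obtain ⟨m, hm, hmq⟩ := ENat.le_natCast_iff.1 htq
        have hjm := ih j hj m hm
        generalize h j = g at hjm ⊢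
        generalize t j = s at hm g hjm ⊢
        subst hm
        obtain ⟨DK, hDK⟩ := E.exists_decomp_K hC m
        obtain ⟨a, ha, b, hb, rfl⟩ := Submodule.mem_sup.1
          (SourceGrading.radPow_le_part (G := G) (DX := DK) _ hjm)
        refine ⟨a, fun _ => ⟨?_, ?_, fun m' hm' => ?_⟩⟩
        · have := SourceGrading.comp_mem_part hDK ha
          rwa [Nat.sub_add_cancel hmq] at this
        · have := radPow_comp_radPow k hb (E.incl_mem m)
          rw [add_sub_cancel_left]
          convert this using 2
          omega
        · obtain rfl : m = m' := by exact_mod_cast hm'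
          rw [add_sub_cancel_left, Nat.succ_sub hmq]
          exact hb
      · refine ⟨0, fun _ => ⟨?_, ?_, fun m hm => ?_⟩⟩
        · rw [Limits.zero_comp]
          exact Submodule.zero_mem _
        · refine comp_radPow k _ (E.incl_mem_of_le ?_)
          push_cast
          exact Order.add_one_le_of_lt (lt_of_not_ge htq)
        · rw [hm, Nat.cast_le, not_le] at htq
          rw [Nat.sub_eq_zero_of_le htq]
          exact Submodule.mem_top
    choose a ha using hex
    have hsum : ∑ j ∈ T, a j ≫ subIncl k (E.K (t j)) = 0 := by
      refine SourceGrading.eq_zero_of_mem_part (G := G) (DX := DX) (m := q)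
        (Submodule.sum_mem _ fun j hj => (ha j hj).1) ?_
      have h1 : ∑ j ∈ T, a j ≫ subIncl k (E.K (t j)) =
          ∑ j ∈ T, h j ≫ subIncl k (E.K (t j)) -
            ∑ j ∈ T, (h j - a j) ≫ subIncl k (E.K (t j)) := by
        simp only [Preadditive.sub_comp, Finset.sum_sub_distrib, sub_sub_cancel]
      rw [h1]
      exact Submodule.sub_mem _ (radPow_antitone k Z X hq hl)
        (Submodule.sum_mem _ fun j hj => (ha j hj).2.1)
    have h0 := eq_zero_of_sum_comp_subIncl (E.indep.comp ht) T a hsum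
    intro j hj m hm
    have := (ha j hj).2.2 m hm
    rwa [h0 j hj, sub_zero] at this

/-- If the inclusion of `L` were in `radᵐ⁺¹`, the absence of cancellation would put the split
monomorphism `L → K⁽ᵐ⁾` in the radical, and with it the identity of `L`. -/
theorem summand_incl_mem
    (hG : ∀ W : FGModuleCat.{u} A, IsIndec W → Nonempty (SourceGrading hC F W))
    {m : ℕ} {L L' : Submodule A X} (hd : Disjoint L L') (hs : L ⊔ L' = E.K m)
    (hL : IsIndec (subObj k L)) :
    subIncl k L ∈ radPow k m (subObj k L) X ∧ subIncl k L ∉ radPow k (m + 1) (subObj k L) X := by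
  have hle : L ≤ E.K m := hs ▸ le_sup_left
  refine ⟨by rw [← subLE_comp hle]; exact comp_radPow k _ (E.incl_mem m), fun hmem => ?_⟩
  obtain ⟨G⟩ := hG _ hL
  have h1 := E.mem_radPow_of_sum_mem G (τ := Unit) {()} (t := fun _ => (m : ℕ∞))
    (fun _ _ _ => rfl) (fun _ => subLE k hle) (l := m + 1) (by simpa using hmem) ()
    (by simp) m rfl
  rw [Nat.add_sub_cancel_left] at h1
  let M : Bool → Submodule A X := fun b => if b then L else L'
  have hMi : iSupIndep M := by
    rw [iSupIndep_pair (i := true) (j := false) (by simp) (by simp)]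
    simpa [M] using hd
  have hMs : ⨆ b, M b = E.K m := by
    rw [iSup_bool_eq]
    simpa [M] using hs
  obtain ⟨B, hB⟩ := nonempty_sumData_of_iSupIndep k hMi hMs
  have h2 : B.inj true = subLE k hle := by
    rw [← cancel_mono (subIncl k (E.K m)), hB]
    rfl
  have h3 : subLE k hle ≫ B.proj true = 𝟙 _ := h2 ▸ B.inj_proj true
  have h4 := (mem_radPow_one_iff k).1 (radPow_comp k h1 (B.proj true))
  rw [h3] at h4
  have := hL.1
  exact id_not_mem_catRad k (subObj k L) h4

end KernelDecomp

end Kernel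

/-! ### The left degree and exactness on the radical layers. -/

section Exactness

variable {k : Type w} [Field k] {A : Type u} [Ring A] [Algebra k A]

theorem radGrComp_mk (Z : FGModuleCat.{u} A) {X Y : FGModuleCat.{u} A} (g : X ⟶ Y) {a b c : ℕ}
    (hg : g ∈ radPow k b X Y) (h : a + b = c) (v : radPow k a Z X) :
    radGrComp k Z g hg h (Submodule.Quotient.mk v) =
      Submodule.Quotient.mk ⟨v.1 ≫ g, h ▸ radPow_comp_radPow k v.2 hg⟩ := rfl

/-- The infimum of a nonempty subset of `ℕ∞` is attained, and the empty set would give `⊤`. -/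
theorem exists_leftDegree_witness {d n : ℕ} {X Y : FGModuleCat.{u} A} {f : X ⟶ Y}
    (hn : leftDegree k d f = (n : ℕ∞)) :
    ∃ (Z : FGModuleCat.{u} A) (g : Z ⟶ X), IsIndec Z ∧ g ∈ radPow k n Z X ∧
      g ∉ radPow k (n + 1) Z X ∧ g ≫ f ∈ radPow k (n + d + 1) Z Y := by
  rw [leftDegree, ← sInf_image] at hn
  have hne : ((fun m : ℕ => (m : ℕ∞)) '' {m : ℕ | ∃ (Z : FGModuleCat.{u} A) (g : Z ⟶ X),
      IsIndec Z ∧ g ∈ radPow k m Z X ∧ g ∉ radPow k (m + 1) Z X ∧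
      g ≫ f ∈ radPow k (m + d + 1) Z Y}).Nonempty := by
    by_contra h
    rw [Set.not_nonempty_iff_eq_empty] at h
    rw [h, sInf_empty] at hn
    exact ENat.natCast_ne_top n hn.symm
  have hmem := csInf_mem hne
  rw [hn] at hmem
  obtain ⟨m, hm, hmn⟩ := hmem
  obtain rfl : m = n := Nat.cast_injective hmn
  exact hm

theorem le_of_leftDegree {d n : ℕ} {X Y : FGModuleCat.{u} A} {f : X ⟶ Y}
    (hn : leftDegree k d f = (n : ℕ∞)) {m : ℕ} {Z : FGModuleCat.{u} A} {g : Z ⟶ X}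
    (hZ : IsIndec Z) (hg : g ∈ radPow k m Z X) (hg' : g ∉ radPow k (m + 1) Z X)
    (hgf : g ≫ f ∈ radPow k (m + d + 1) Z Y) : n ≤ m := by
  have : leftDegree k d f ≤ m := iInf₂_le m ⟨Z, g, hZ, hg, hg', hgf⟩
  rw [hn] at this
  exact_mod_cast this

/-- The passage between `f`, for which the left degree and the sequence are stated, and `f'`, whose
kernel is taken. -/
theorem comp_mem_of_sub_mem {d m : ℕ} {X Y Z : FGModuleCat.{u} A} {f f' : X ⟶ Y} {g : Z ⟶ X}
    (hg : g ∈ radPow k m Z X) (hff : f - f' ∈ radPow k (d + 1) X Y) :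
    g ≫ f ∈ radPow k (m + d + 1) Z Y ↔ g ≫ f' ∈ radPow k (m + d + 1) Z Y := by
  have h := radPow_comp_radPow k hg hff
  rw [Preadditive.comp_sub, ← Nat.add_assoc] at h
  exact ⟨fun h1 => by simpa using Submodule.sub_mem _ h1 h,
    fun h1 => by simpa using Submodule.add_mem _ h h1⟩

variable [FiniteDimensional k A]
variable {C : Type u'} [Category.{v'} C] [Preadditive C] [Linear k C]
variable {F : C ⥤ FGModuleCat.{u} A}
variable {hC : IsWithLength k C}

namespace KernelDecomp

variable {X Y : FGModuleCat.{u} A} {DX : Decomp F X} {DY : Decomp F Y} {f f' : X ⟶ Y} {d n : ℕ}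
  (E : KernelDecomp k DX f' n) {l : ℕ} {Z : FGModuleCat.{u} A}

theorem sum_comp_mem (v : ∀ m : Finset.Icc n l, radPow k (l - m.1) Z (subObj k (E.K (m.1 : ℕ∞)))) :
    ∑ m, (v m).1 ≫ subIncl k (E.K (m.1 : ℕ∞)) ∈ radPow k l Z X := by
  refine Submodule.sum_mem _ fun m _ => ?_
  have := radPow_comp_radPow k (v m).2 (E.incl_mem m.1)
  rwa [Nat.sub_add_cancel (Finset.mem_Icc.1 m.2).2] at this

/-- The element of the direct sum represented by a family of morphisms. -/
def ofFamily (v : ∀ m : Finset.Icc n l, radPow k (l - m.1) Z (subObj k (E.K (m.1 : ℕ∞)))) :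
    ⨁ m : Finset.Icc n l, RadGr k (l - m.1) Z (subObj k (E.K (m.1 : ℕ∞))) :=
  ∑ m, DirectSum.lof k (Finset.Icc n l)
    (fun m => RadGr k (l - m.1) Z (subObj k (E.K (m.1 : ℕ∞)))) m (Submodule.Quotient.mk (v m))

theorem exists_eq_ofFamily
    (ξ : ⨁ m : Finset.Icc n l, RadGr k (l - m.1) Z (subObj k (E.K (m.1 : ℕ∞)))) :
    ∃ v, ξ = E.ofFamily v := by
  choose v hv using fun m => Submodule.Quotient.mk_surjective _ (ξ m)
  refine ⟨v, (DirectSum.sum_univ_of ξ).symm.trans (Finset.sum_congr rfl fun m _ => ?_)⟩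
  rw [hv]
  rfl

theorem inclMap_ofFamily
    (v : ∀ m : Finset.Icc n l, radPow k (l - m.1) Z (subObj k (E.K (m.1 : ℕ∞)))) :
    E.inclMap k l Z (E.ofFamily v) =
      Submodule.Quotient.mk ⟨∑ m, (v m).1 ≫ subIncl k (E.K (m.1 : ℕ∞)), E.sum_comp_mem v⟩ := by
  simp only [inclMap, ofFamily, map_sum, DirectSum.toModule_lof, radGrComp_mk]
  refine (map_sum (Submodule.mkQ _) (fun m => (⟨(v m).1 ≫ subIncl k (E.K (m.1 : ℕ∞)), _⟩ :
    radPow k l Z X)) Finset.univ).symm.trans ?_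
  rw [Submodule.mkQ_apply, gr_mk_eq, AddSubmonoidClass.coe_finsetSum, sub_self]
  exact Submodule.zero_mem _

/-- The absence of cancellation applied in `radˡ⁺¹`: each component gains one degree, hence is zero
in its layer. -/
theorem inclMap_injective (G : SourceGrading hC F Z) : Function.Injective (E.inclMap k l Z) := by
  rw [injective_iff_map_eq_zero]
  intro ξ hξ
  obtain ⟨v, rfl⟩ := E.exists_eq_ofFamily ξ
  rw [inclMap_ofFamily, gr_mk_eq_zero] at hξ
  have h := E.mem_radPow_of_sum_mem G (τ := Finset.Icc n l) Finset.univ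
    (t := fun m => (m.1 : ℕ∞)) (fun a b hab => Subtype.ext (Nat.cast_injective hab))
    (fun m => (v m).1) hξ
  refine Finset.sum_eq_zero fun m _ => ?_
  have hm := h m (Finset.mem_univ m) m.1 rfl
  rw [Nat.sub_add_comm (Finset.mem_Icc.1 m.2).2] at hm
  rw [(gr_mk_eq_zero (v m)).2 hm, map_zero]

/-- A class killed by `f` is represented by its leading term `a`, which factors through the kernel.
Since `a ∈ radˡ`, its component in `K⁽ᵐ⁾` lies in `radˡ⁻ᵐ`. -/
theorem exact_inclMap (G : SourceGrading hC F Z) (hf : f ∈ radPow k d X Y)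
    (hff : f - f' ∈ radPow k (d + 1) X Y) (hf' : IsHomogeneousOfDegree k d DX DY f') :
    Function.Exact (E.inclMap k l Z)
      (radGrComp k Z f hf rfl : RadGr k l Z X →ₗ[k] RadGr k (l + d) Z Y) := by
  classical
  have hfd : f' ∈ radPow k d X Y := by
    rw [← sub_sub_cancel f f']
    exact Submodule.sub_mem _ hf (radPow_antitone k X Y (Nat.le_succ d) hff)
  intro y
  constructor
  · intro hy
    obtain ⟨⟨g, hg⟩, rfl⟩ := Submodule.Quotient.mk_surjective _ y
    rw [radGrComp_mk, gr_mk_eq_zero] at hy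
    obtain ⟨a, ha, haf, hga⟩ := SourceGrading.exists_part_comp_eq_zero (G := G) hf' hg
      ((comp_mem_of_sub_mem hg hff).1 hy) hfd
    obtain ⟨T, h, hah⟩ := exists_sum_comp_subIncl k E.indep a
      fun z => E.iSup_eq ▸ mem_ker_of_comp_eq_zero haf z
    have hmem := E.mem_radPow_of_sum_mem G T (t := fun t => t) (fun _ _ h => h) h
      (l := l) (hah ▸ SourceGrading.part_le l ha)
    -- The degree of `h t` is controlled only for `t ∈ T`; elsewhere the component of `a` is taken
    -- to be zero.
    let h' : ∀ t, Z ⟶ subObj k (E.K t) := fun t => if t ∈ T then h t else 0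
    have h'mem : ∀ m : ℕ, h' m ∈ radPow k (l - m) Z (subObj k (E.K m)) := fun m => by
      by_cases hm : (m : ℕ∞) ∈ T
      · simpa only [h', if_pos hm] using hmem m hm m rfl
      · simp only [h', if_neg hm]
        exact Submodule.zero_mem _
    refine ⟨E.ofFamily fun m => ⟨h' m.1, h'mem m.1⟩, ?_⟩
    rw [inclMap_ofFamily, gr_mk_eq]
    let p : ℕ∞ → (Z ⟶ X) := fun t => h' t ≫ subIncl k (E.K t)
    let I : Finset ℕ∞ := (Finset.Icc n l).image fun m : ℕ => (m : ℕ∞)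
    have hI : ∑ m : Finset.Icc n l, p m.1 = ∑ t ∈ I, p t := by
      rw [Finset.sum_image fun a _ b _ hab => by exact_mod_cast hab,
        Finset.sum_coe_sort (Finset.Icc n l) fun m : ℕ => p m]
    have hT : a = ∑ t ∈ T ∪ I, p t := by
      rw [hah, ← Finset.sum_subset (Finset.subset_union_left (s₁ := T) (s₂ := I))]
      · exact Finset.sum_congr rfl fun t ht => by simp [p, h', ht]
      · intro t _ ht
        simp [p, h', ht]
    -- The terms outside `n ≤ t ≤ l` do not affect the layer: for `t > l` the inclusion lies in
    -- `radˡ⁺¹`, and for `t < n` the summand is zero.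
    have hrest : ∑ t ∈ (T ∪ I) \ I, p t ∈ radPow k (l + 1) Z X := by
      refine Submodule.sum_mem _ fun t ht => ?_
      have htI : t ∉ I := (Finset.mem_sdiff.1 ht).2
      by_cases hl : ((l + 1 : ℕ) : ℕ∞) ≤ t
      · exact comp_radPow k _ (E.incl_mem_of_le hl)
      · lift t to ℕ using (lt_of_not_ge hl).ne_top
        have htl : t < l + 1 := by exact_mod_cast lt_of_not_ge hl
        have htn : t < n := by
          by_contra hn
          exact htI (Finset.mem_image_of_mem _ (Finset.mem_Icc.2 ⟨not_lt.1 hn, by omega⟩))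
        have : p t = 0 := by
          simp only [p, subIncl_eq_zero (E.eq_bot t htn), Limits.comp_zero]
        rw [this]
        exact Submodule.zero_mem _
    change ∑ m : Finset.Icc n l, p m.1 - g ∈ _
    have hsum : ∑ m : Finset.Icc n l, p m.1 - g = -(g - a) - ∑ t ∈ (T ∪ I) \ I, p t := by
      rw [hI, hT, ← Finset.sum_sdiff (Finset.subset_union_right (s₁ := T) (s₂ := I))]
      abel
    rw [hsum]
    exact Submodule.sub_mem _ (Submodule.neg_mem _ hga) hrest
  · rintro ⟨ξ, rfl⟩
    obtain ⟨v, rfl⟩ := E.exists_eq_ofFamily ξ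
    rw [inclMap_ofFamily, radGrComp_mk, gr_mk_eq_zero]
    refine (comp_mem_of_sub_mem (E.sum_comp_mem v) hff).2 ?_
    rw [Preadditive.sum_comp]
    refine Submodule.sum_mem _ fun m _ => ?_
    rw [Category.assoc, subIncl_comp_eq_zero (E.K_le _), Limits.comp_zero]
    exact Submodule.zero_mem _

end KernelDecomp

end Exactness

end RadDegree

end

/-! ### The main theorem. -/

theorem theoremA
    {k : Type w} [Field k] [PerfectField k]
    {A : Type u} [Ring A] [Algebra k A] [FiniteDimensional k A]
    {indA Γ : Set (FGModuleCat.{u} A)} (hind : IsIndRepresentatives indA)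
    (hΓ : IsARComponent k indA Γ)
    {C : Type u'} [Category.{v'} C] [Preadditive C] [Linear k C] (hC : IsWithLength k C)
    (F : C ⥤ FGModuleCat.{u} A) [F.Additive] [F.Linear k] (hF : HasCoveringProperty k F Γ)
    {X Y : FGModuleCat.{u} A} (f : X ⟶ Y) (d n : ℕ)
    (hf : f ∈ radPow k d X Y) (hf' : f ∉ radPow k (d + 1) X Y)
    (hhom : IsHomogeneousUpTo k F (d + 1) f)
    (hn : leftDegree k d f = (n : ℕ∞)) :
    -- the homogeneous part of `f` exists
    (∃ (DX : Decomp F X) (DY : Decomp F Y) (f' : X ⟶ Y), IsHomogeneousPart k d DX DY f f') ∧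
    ∀ (DX : Decomp F X) (DY : Decomp F Y) (f' : X ⟶ Y), IsHomogeneousPart k d DX DY f f' →
      -- the inclusion of the kernel lies in `radⁿ ∖ radⁿ⁺¹`
      (subIncl k (LinearMap.ker f'.hom.hom) ∈
          radPow k n (subObj k (LinearMap.ker f'.hom.hom)) X ∧
        subIncl k (LinearMap.ker f'.hom.hom) ∉
          radPow k (n + 1) (subObj k (LinearMap.ker f'.hom.hom)) X) ∧
      -- there are decompositions of the kernel as claimed
      Nonempty (KernelDecomp k DX f' n) ∧
      ∀ E : KernelDecomp k DX f' n,
        -- every indecomposable direct summand of `K⁽ᵐ⁾` is included by a map in `radᵐ ∖ radᵐ⁺¹`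
        (∀ (m : ℕ) (L L' : Submodule A X), Disjoint L L' → L ⊔ L' = E.K m →
          IsIndec (subObj k L) →
          subIncl k L ∈ radPow k m (subObj k L) X ∧
            subIncl k L ∉ radPow k (m + 1) (subObj k L) X) ∧
        -- the sequences are exact
        ∀ (l : ℕ), n ≤ l → ∀ Z : FGModuleCat.{u} A, IsIndec Z →
          Function.Injective (E.inclMap k l Z) ∧
          Function.Exact (E.inclMap k l Z)
            (radGrComp k Z f hf rfl : RadGr k l Z X →ₗ[k] RadGr k (l + d) Z Y) := by
  have hG : ∀ W : FGModuleCat.{u} A, IsIndec W → Nonempty (SourceGrading hC F W) :=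
    fun W hW => nonempty_sourceGrading hC hind hΓ hF hW
  refine ⟨exists_homogeneousPart hC hF hf hhom, ?_⟩
  rintro DX DY f' ⟨hff, hhf⟩
  have hfd : f' ∈ radPow k d X Y := by
    rw [← sub_sub_cancel f f']
    exact Submodule.sub_mem _ hf (radPow_antitone k X Y (Nat.le_succ d) hff)
  have hE : Nonempty (KernelDecomp k DX f' n) := by
    refine nonempty_kernelDecomp hG hhf hfd fun m Z g hZ hg hg' hgf => ?_
    refine le_of_leftDegree hn hZ hg hg' ((comp_mem_of_sub_mem hg hff).2 ?_)
    rw [hgf]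
    exact Submodule.zero_mem _
  refine ⟨⟨hE.some.subIncl_ker_mem, fun hmem => ?_⟩, hE, fun E => ⟨?_, ?_⟩⟩
  -- A morphism `g` realizing the left degree has a leading term `a` that factors through the
  -- kernel. An inclusion in `radⁿ⁺¹` would put `a`, and then `g`, in `radⁿ⁺¹`.
  · obtain ⟨Z, g, hZ, hg, hg', hgf⟩ := exists_leftDegree_witness hn
    obtain ⟨G⟩ := hG Z hZ
    obtain ⟨a, -, haf, hga⟩ := SourceGrading.exists_part_comp_eq_zero (G := G) hhf hg
      ((comp_mem_of_sub_mem hg hff).1 hgf) hfd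
    apply hg'
    rw [← sub_add_cancel g a]
    refine Submodule.add_mem _ hga ?_
    rw [← liftSub_comp (k := k) _ a (mem_ker_of_comp_eq_zero haf)]
    exact comp_radPow k _ hmem
  · intro m L L' hd hs hL
    exact E.summand_incl_mem hG hd hs hL
  · intro l _ Z hZ
    obtain ⟨G⟩ := hG Z hZ
    exact ⟨E.inclMap_injective G, E.exact_inclMap G hf hff hhf⟩
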